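/- A representation of a set $X$ is a surjective partial function $\delta_X:\subseteq\mathbb N^{\mathbb N}\to X$; the $p$ with $\delta_X(p)=x$ are the names of $x$. A partial function $F:\subseteq\mathbb N^{\mathbb N}\to\mathbb N^{\mathbb N}$ is computable if one program with oracle $p$ computes from every $i$ the entry $F(p)(i)$. A partial function $F:\subseteq\mathbb N^{\mathbb N}\to\mathbb N^{\mathbb N}$ realizes a partial multi-valued function $f:\subseteq X\rightrightarrows Y$ between represented spaces, written $F\vdash f$, if $\delta_Y(F(p))\in f(\delta_X(p))$ for every $p$ with $\delta_X(p)\in\operatorname{dom}(f)$. One writes $f\le_{\mathrm{sW}}g$ if there are computable $H,K:\subseteq\mathbb N^{\mathbb N}\to\mathbb N^{\mathbb N}$ such that $K\circ G\circ H\vdash f$ whenever $G\vdash g$, and $f\equiv_{\mathrm{sW}}g$ if $f\le_{\mathrm{sW}}g$ and $g\le_{\mathrm{sW}}f$. Pairs $(x,y)$ are named by $\langle p,q\rangle=p(0)q(0)p(1)q(1)\dots$ with $p$ a name of $x$ and $q$ a name of $y$. Let $\mathbb R^n$ carry the Euclidean metric $d$, let $\alpha:\mathbb N\to\mathbb Q^n$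 be an effective enumeration of $\mathbb Q^n$, and let $(B_k)_{k\in\mathbb N}$ be the induced effective enumeration of the open balls with center in $\mathbb Q^n$ and rational radius $\ge 0$. A name of a point $x\in\mathbb R^n$ is a $p\in\mathbb N^{\mathbb N}$ with $d(\alpha(p(i)),\alpha(p(j)))\le 2^{-i}$ for all $i\le j$ and $\lim_i\alpha(p(i))=x$. A name (with total information) of a nonempty closed set $A\subseteq\mathbb R^n$ is a $\langle p,q\rangle$ such that $A=\mathbb R^n\setminus\bigcup_{k\in\operatorname{range}(p)}B_k$ and, for every $k$, $k\in\operatorname{range}(q)$ if and only if $B_k\cap A\neq\emptyset$. The exact total projection operator $\operatorname{Proj}_{\mathbb R^n}$ maps a point $x\in\mathbb R^n$ and a nonempty closed set $A\subseteq\mathbb R^n$ to the set of all $y\in A$ with $d(x,y)=d(x,A)=\inf\{d(x,z):z\in A\}$. The operator $\operatorname{WKL}$ maps each infinite binary tree $T\subseteq 2^{<\mathbb N}$ to the set $[T]\subseteq 2^{\mathbb N}$ of its infinite paths; here $T$ is named by its characteristic function along a recursive enumeration of all finite binary words, and an element of $2^{\mathbb N}$ is its own name. Then, for every $n\ge 2$,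 $$\operatorname{Proj}_{\mathbb R^n}\equiv_{\mathrm{sW}}\operatorname{WKL}.$$ -/

import Mathlib

open Filter Topology

noncomputable section

namespace Wei

/-- Baire space, the set of names. -/
abbrev Baire : Type := ℕ → ℕ

/-- Partial recursive functionals with an oracle `p`: the programs `Φ` such that `Φ p n` is the
result, if any, of running a fixed oracle program on the number `n` with the oracle `p`. The
clauses are those of `Nat.Partrec`, uniformly in the oracle, with one more basic program, which
queries the oracle. -/
inductive OracleProgram : (Baire → ℕ →. ℕ) → Prop
  | oracle : OracleProgram fun p n => Part.some (p n)
  | zero : OracleProgram fun _ _ => Part.some 0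
  | succ : OracleProgram fun _ n => Part.some (n + 1)
  | left : OracleProgram fun _ n => Part.some n.unpair.1
  | right : OracleProgram fun _ n => Part.some n.unpair.2
  | pair {Φ Ψ : Baire → ℕ →. ℕ} : OracleProgram Φ → OracleProgram Ψ →
      OracleProgram fun p n => Nat.pair <$> Φ p n <*> Ψ p n
  | comp {Φ Ψ : Baire → ℕ →. ℕ} : OracleProgram Φ → OracleProgram Ψ →
      OracleProgram fun p n => Ψ p n >>= Φ p
  | prec {Φ Ψ : Baire → ℕ →. ℕ} : OracleProgram Φ → OracleProgram Ψ →
      OracleProgram fun p => Nat.unpaired fun a n =>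
        n.rec (Φ p a) fun y IH => do
          let i ← IH
          Ψ p (Nat.pair a (Nat.pair y i))
  | rfind {Φ : Baire → ℕ →. ℕ} : OracleProgram Φ →
      OracleProgram fun p a => Nat.rfind fun n => (fun m => m = 0) <$> Φ p (Nat.pair a n)

/-- A partial function on Baire space is computable if one oracle program, given the input `p` as
an oracle, computes every entry of the output; the input is in the domain exactly if all the
entries of the output get computed. -/
def ComputableOnBaire (F : Baire →. Baire) : Prop :=
  ∃ Φ : Baire → ℕ →. ℕ, OracleProgram Φ ∧ ∀ p q : Baire, q ∈ F p ↔ ∀ n, q n ∈ Φ p n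

/-- A representation of `X`: a surjective partial function from Baire space to `X`, given by its
graph (`IsName p x` says that the value at `p` is `x`). -/
structure Representation (X : Type) where
  IsName : Baire → X → Prop
  unique : ∀ {p : Baire} {x y : X}, IsName p x → IsName p y → x = y
  surj : ∀ x : X, ∃ p : Baire, IsName p x

/-- A partial multi-valued function. -/
structure MultiFun (X Y : Type) where
  dom : Set X
  val : X → Set Y

/-- `F` is a realizer of `f`. -/
def Realizes {X Y : Type} (δX : Representation X) (δY : Representation Y)
    (F : Baire →. Baire) (f : MultiFun X Y) : Prop :=
  ∀ (p : Baire) (x : X), δX.IsName p x → x ∈ f.dom →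
    ∃ q ∈ F p, ∃ y ∈ f.val x, δY.IsName q y

/-- A problem: a partial multi-valued function between represented spaces. -/
structure Problem where
  In : Type
  Out : Type
  repIn : Representation In
  repOut : Representation Out
  fn : MultiFun In Out

/-- Realizers of a problem. -/
def Problem.RealizedBy (f : Problem) (F : Baire →. Baire) : Prop :=
  Realizes f.repIn f.repOut F f.fn

/-- Strong Weihrauch reducibility. -/
def StrongWeihrauchLE (f g : Problem) : Prop :=
  ∃ H K : Baire →. Baire, ComputableOnBaire H ∧ ComputableOnBaire K ∧
    ∀ G : Baire →. Baire, g.RealizedBy G → f.RealizedBy (K.comp (G.comp H))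

/-- Strong Weihrauch equivalence. -/
def StrongWeihrauchEquiv (f g : Problem) : Prop :=
  StrongWeihrauchLE f g ∧ StrongWeihrauchLE g f

/-! ### Pairs -/

/-- The sequence `⟨p, q⟩ = p 0, q 0, p 1, q 1, …`. -/
def join (p q : Baire) : Baire := fun n => if n % 2 = 0 then p (n / 2) else q (n / 2)

theorem join_even (p q : Baire) (n : ℕ) : join p q (2 * n) = p n := by
  simp [join]

theorem join_odd (p q : Baire) (n : ℕ) : join p q (2 * n + 1) = q n := by
  have h : (2 * n + 1) % 2 = 1 := by omega
  have h' : (2 * n + 1) / 2 = n := by omega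
  simp [join, h, h']

theorem join_inj {p q p' q' : Baire} (h : join p q = join p' q') : p = p' ∧ q = q' := by
  constructor
  · funext n
    rw [← join_even p q, h, join_even]
  · funext n
    rw [← join_odd p q, h, join_odd]

/-- The product representation. -/
def Representation.prod {X Y : Type} (δX : Representation X) (δY : Representation Y) :
    Representation (X × Y) where
  IsName r z := ∃ p q, r = join p q ∧ δX.IsName p z.1 ∧ δY.IsName q z.2
  unique := by
    rintro r z w ⟨p, q, rfl, hp, hq⟩ ⟨p', q', h, hp', hq'⟩
    obtain ⟨rfl, rfl⟩ := join_inj h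
    exact Prod.ext (δX.unique hp hp') (δY.unique hq hq')
  surj z := by
    obtain ⟨p, hp⟩ := δX.surj z.1
    obtain ⟨q, hq⟩ := δY.surj z.2
    exact ⟨join p q, p, q, rfl, hp, hq⟩

/-! ### Weak Kőnig's Lemma -/

/-- Binary trees: sets of finite binary words that are closed under initial segments. -/
def BinTree : Type :=
  {T : Set (List Bool) // ∀ w ∈ T, ∀ v : List Bool, v <+: w → v ∈ T}

/-- A recursive enumeration of all finite binary words. -/
def word (n : ℕ) : List Bool := (Encodable.decode (α := List Bool) n).getD []

theorem word_encode (w : List Bool) : word (Encodable.encode w) = w := by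
  simp [word]

/-- Trees are represented by their characteristic functions. -/
def treeRep : Representation BinTree where
  IsName t T := ∀ n, (t n = 0 ∨ t n = 1) ∧ (t n = 1 ↔ word n ∈ T.1)
  unique := by
    intro t S T hS hT
    apply Subtype.ext
    ext w
    rw [← word_encode w, ← (hS _).2, (hT _).2]
  surj T := by
    classical
    refine ⟨fun n => if word n ∈ T.1 then 1 else 0, fun n => ?_⟩
    by_cases h : word n ∈ T.1 <;> simp [h]

/-- The representation of Cantor space: each sequence of bits is its own name. -/
def cantorRep : Representation (ℕ → Bool) where
  IsName p x := ∀ n, p n = (x n).toNat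
  unique := by
    intro p x y hx hy
    funext n
    have h : (x n).toNat = (y n).toNat := by rw [← hx, hy]
    revert h
    cases x n <;> cases y n <;> simp
  surj x := ⟨fun n => (x n).toNat, fun _ => rfl⟩

/-- The infinite paths of a binary tree. -/
def paths (T : BinTree) : Set (ℕ → Bool) :=
  {x | ∀ n, (List.range n).map x ∈ T.1}

/-- Weak Kőnig's Lemma: given an infinite binary tree, find an infinite path. -/
def WKL : Problem where
  In := BinTree
  Out := ℕ → Bool
  repIn := treeRep
  repOut := cantorRep
  fn :=
    { dom := {T | T.1.Infinite}
      val := paths }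

/-! ### Euclidean space as a computable metric space -/

/-- The `n`-dimensional Euclidean space, with the Euclidean metric. -/
abbrev Euc (n : ℕ) : Type := EuclideanSpace ℝ (Fin n)

/-- An effective enumeration of the rational numbers: the code `⟨⟨a, b⟩, c⟩` stands for
`(a - b) / (c + 1)`. -/
def ratNum (k : ℕ) : ℚ :=
  ((k.unpair.1.unpair.1 : ℚ) - k.unpair.1.unpair.2) / (k.unpair.2 + 1)

/-- An effective enumeration of the nonnegative rational numbers: the code `⟨a, b⟩` stands for
`a / (b + 1)`. -/
def nonnegRatNum (k : ℕ) : ℚ := (k.unpair.1 : ℚ) / (k.unpair.2 + 1)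

/-- The entry with index `i` of the sequence coded by `⟨k₀, ⟨k₁, ⟨k₂, …⟩⟩⟩`. -/
def entry : ℕ → ℕ → ℕ
  | 0, k => k.unpair.1
  | i + 1, k => entry i k.unpair.2

/-- An effective enumeration of the points with rational coordinates. -/
def ratPoint (n : ℕ) (k : ℕ) : Euc n :=
  WithLp.toLp 2 fun i => ((ratNum (entry i k) : ℚ) : ℝ)

/-- The basic open ball with the code `⟨a, b⟩`. -/
def basicBall (n : ℕ) (k : ℕ) : Set (Euc n) :=
  Metric.ball (ratPoint n k.unpair.1) ((nonnegRatNum k.unpair.2 : ℚ) : ℝ)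

theorem ratNum_surj (q : ℚ) : ∃ k, ratNum k = q := by
  refine ⟨Nat.pair (Nat.pair q.num.toNat (-q.num).toNat) (q.den - 1), ?_⟩
  have h1 : ((q.num.toNat : ℚ) - ((-q.num).toNat : ℚ)) = (q.num : ℚ) := by
    exact_mod_cast congrArg (Int.cast (R := ℚ)) (show ((q.num.toNat : ℤ) - ((-q.num).toNat : ℤ)) =
      q.num by omega)
  have h2 : (((q.den - 1 : ℕ) : ℚ) + 1) = q.den := by
    have := q.den_pos
    exact_mod_cast (show q.den - 1 + 1 = q.den by omega)
  simp only [ratNum, Nat.unpair_pair, h1, h2]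
  exact q.num_div_den

theorem nonnegRatNum_surj {q : ℚ} (hq : 0 ≤ q) : ∃ k, nonnegRatNum k = q := by
  refine ⟨Nat.pair q.num.toNat (q.den - 1), ?_⟩
  have h1 : (q.num.toNat : ℚ) = (q.num : ℚ) := by
    have := Rat.num_nonneg.2 hq
    exact_mod_cast congrArg (Int.cast (R := ℚ)) (show (q.num.toNat : ℤ) = q.num by omega)
  have h2 : (((q.den - 1 : ℕ) : ℚ) + 1) = q.den := by
    have := q.den_pos
    exact_mod_cast (show q.den - 1 + 1 = q.den by omega)
  simp only [nonnegRatNum, Nat.unpair_pair, h1, h2]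
  exact q.num_div_den

theorem entry_surj (n : ℕ) : ∀ v : ℕ → ℕ, ∃ k, ∀ i < n, entry i k = v i := by
  induction n with
  | zero => exact fun v => ⟨0, fun i hi => absurd hi (Nat.not_lt_zero i)⟩
  | succ n ih =>
    intro v
    obtain ⟨k, hk⟩ := ih fun i => v (i + 1)
    refine ⟨Nat.pair (v 0) k, fun i hi => ?_⟩
    cases i with
    | zero => simp [entry]
    | succ i => simpa [entry] using hk i (by omega)

theorem ratPoint_surj {n : ℕ} (v : Fin n → ℚ) :
    ∃ k, ratPoint n k = WithLp.toLp 2 fun i => (v i : ℝ) := by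
  choose c hc using fun i => ratNum_surj (v i)
  obtain ⟨k, hk⟩ := entry_surj n fun i => if h : i < n then c ⟨i, h⟩ else 0
  refine ⟨k, ?_⟩
  unfold ratPoint
  congr 1
  funext i
  rw [hk i i.2]
  simp [hc]

theorem ratPoint_dense (n : ℕ) : DenseRange (ratPoint n) := by
  have h1 : DenseRange fun v : Fin n → ℚ => fun i => (v i : ℝ) :=
    DenseRange.piMap fun _ => Rat.denseRange_cast
  have h2 : DenseRange fun v : Fin n → ℚ => (WithLp.toLp 2 fun i => (v i : ℝ) : Euc n) :=
    (WithLp.toLp_surjective 2).denseRange.comp h1 (PiLp.continuous_toLp 2 _)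
  refine h2.mono ?_
  rintro _ ⟨v, rfl⟩
  exact ratPoint_surj v

/-- Between a point and an open set that contains it there is a basic ball. -/
theorem exists_basicBall {n : ℕ} {U : Set (Euc n)} (hU : IsOpen U) {x : Euc n} (hx : x ∈ U) :
    ∃ k, x ∈ basicBall n k ∧ basicBall n k ⊆ U := by
  obtain ⟨ε, hε, hb⟩ := Metric.isOpen_iff.1 hU x hx
  obtain ⟨q, hq0, hq⟩ := exists_rat_btwn (half_pos hε)
  obtain ⟨a, ha⟩ := (ratPoint_dense n).exists_dist_lt x hq0
  obtain ⟨b, hb'⟩ := nonnegRatNum_surj (q := q) (by exact_mod_cast hq0.le)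
  refine ⟨Nat.pair a b, ?_, ?_⟩
  · simpa [basicBall, hb'] using ha
  · intro y hy
    apply hb
    simp only [basicBall, Nat.unpair_pair, hb', Metric.mem_ball] at hy ⊢
    have := dist_triangle y (ratPoint n a) x
    rw [dist_comm] at ha
    linarith

/-- The Cauchy representation of Euclidean space. -/
def cauchyRep (n : ℕ) : Representation (Euc n) where
  IsName p x :=
    (∀ i j, i ≤ j → dist (ratPoint n (p i)) (ratPoint n (p j)) ≤ (2 : ℝ)⁻¹ ^ i) ∧
      Tendsto (fun i => ratPoint n (p i)) atTop (𝓝 x)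
  unique hx hy := tendsto_nhds_unique hx.2 hy.2
  surj x := by
    have hpos : ∀ i : ℕ, (0 : ℝ) < (2 : ℝ)⁻¹ ^ i / 2 := fun i => by positivity
    choose p hp using fun i : ℕ => (ratPoint_dense n).exists_dist_lt x (hpos i)
    have hlim : Tendsto (fun i : ℕ => (2 : ℝ)⁻¹ ^ i / 2) atTop (𝓝 0) := by
      have := (tendsto_pow_atTop_nhds_zero_of_lt_one (r := (2 : ℝ)⁻¹) (by norm_num)
        (by norm_num)).div_const 2
      simpa using this
    refine ⟨p, fun i j hij => ?_, ?_⟩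
    · have h1 := dist_triangle_left (ratPoint n (p i)) (ratPoint n (p j)) x
      have h2 : (2 : ℝ)⁻¹ ^ j ≤ (2 : ℝ)⁻¹ ^ i :=
        pow_le_pow_of_le_one (by norm_num) (by norm_num) hij
      linarith [hp i, hp j]
    · rw [tendsto_iff_dist_tendsto_zero]
      refine squeeze_zero (fun _ => dist_nonneg) (fun i => ?_) hlim
      rw [dist_comm]
      exact (hp i).le

/-! ### Closed sets with total information -/

/-- `p` is a negative name of `A`: it lists basic balls whose union is the complement of `A`. -/
def NegName (n : ℕ) (p : Baire) (A : Set (Euc n)) : Prop :=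
  A = (⋃ k ∈ Set.range p, basicBall n k)ᶜ

/-- `p` is a positive name of `A`: it lists exactly the basic balls that meet `A`. -/
def PosName (n : ℕ) (p : Baire) (A : Set (Euc n)) : Prop :=
  ∀ k, k ∈ Set.range p ↔ (basicBall n k ∩ A).Nonempty

/-- The nonempty closed subsets of Euclidean space. -/
def NonemptyClosed (n : ℕ) : Type := {A : Set (Euc n) // IsClosed A ∧ A.Nonempty}

/-- A nonempty set of numbers is the range of a sequence. -/
theorem exists_range_eq {S : Set ℕ} (hS : S.Nonempty) : ∃ p : Baire, Set.range p = S := by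
  obtain ⟨p, hp⟩ := S.to_countable.exists_eq_range hS
  exact ⟨p, hp.symm⟩

/-- The total information representation of the nonempty closed sets: a name joins a negative and
a positive name. (The empty set has no positive name, since the range of a sequence is not
empty.) -/
def closedRep (n : ℕ) : Representation (NonemptyClosed n) where
  IsName r A := ∃ p q, r = join p q ∧ NegName n p A.1 ∧ PosName n q A.1
  unique := by
    rintro r A B ⟨p, q, rfl, hp, -⟩ ⟨p', q', h, hp', -⟩
    obtain ⟨rfl, rfl⟩ := join_inj h
    apply Subtype.ext
    rw [hp, hp']
  surj A := by
    have hneg : ∃ p : Baire, Set.range p = {k | basicBall n k ⊆ A.1ᶜ} :=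
      exists_range_eq ⟨0, by simp [basicBall, nonnegRatNum]⟩
    have hpos : ∃ q : Baire, Set.range q = {k | (basicBall n k ∩ A.1).Nonempty} := by
      obtain ⟨x, hx⟩ := A.2.2
      obtain ⟨k, hk, -⟩ := exists_basicBall isOpen_univ (Set.mem_univ x)
      exact exists_range_eq ⟨k, x, hk, hx⟩
    obtain ⟨p, hp⟩ := hneg
    obtain ⟨q, hq⟩ := hpos
    refine ⟨join p q, p, q, rfl, ?_, fun k => by rw [hq]; rfl⟩
    unfold NegName
    rw [hp, eq_compl_comm]
    ext x
    simp only [Set.mem_iUnion, Set.mem_ofPred_eq, exists_prop]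
    constructor
    · rintro ⟨k, hk, hx⟩
      exact hk hx
    · intro hx
      obtain ⟨k, hk, hkA⟩ := exists_basicBall A.2.1.isOpen_compl hx
      exact ⟨k, hkA, hk⟩

/-! ### Projections -/

/-- The projection points of `x` onto `A`. -/
def projPoints {X : Type} [MetricSpace X] (x : X) (A : Set X) : Set X :=
  {y | y ∈ A ∧ dist x y = Metric.infDist x A}

/-- The exact total projection operator on Euclidean space: given a point and a nonempty closed
set with total information, find a projection point of the point onto the set. -/
def Proj (n : ℕ) : Problem where
  In := Euc n × NonemptyClosed n
  Out := Euc n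
  repIn := (cauchyRep n).prod (closedRep n)
  repOut := cauchyRep n
  fn :=
    { dom := Set.univ
      val := fun z => projPoints z.1 z.2.1 }

end Wei

end

open Filter Topology

noncomputable section

namespace Wei

/-! ### Oracle programs that read a finite initial segment of the oracle -/

/-! Projecting reduces to `WKL` because the projection points of `x` onto `A` form a nonempty
compact set that is co-enumerable from the input. The first entry of the name of `x` and the first
ball of the positive name bound the norm of every projection point, so each has a Cauchy name whose
entries obey explicit bounds (`norm_projPoint_le`, `exists_bounded_name`). That `y` lies outside `A`
is refuted by a ball of the negative name; that `y` is not nearest is refuted by a ball of the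
positive name that is closer to `x`. Hence the graphs of the bounded names are paths of a tree
`projTree` decidable from the input, which is infinite because a nearest point exists
(`infinite_projTree`). Conversely, any path yields a Cauchy name of a projection point, by choosing
for each `i` some `k` whose bit `⟨i, k⟩` is set (`exists_projPoint_of_mem_paths`).

`WKL` reduces to projecting in dimension at least 2 because all points of the unit circle are
equally far from the origin, which leaves room to code Cantor space. A word `w` is read as an octal
expansion with digits 0 and 1, sent to the circle by the rational parametrization, and moved
outwards to radius `1 + 8⁻¹ ^ |w| / 16`. The closure of the points coded by an infinite tree has
total information computable from the tree: balls meeting it are recognized by the coded points, and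
disjoint balls by finitely many levels, since all extensions of a word stay close to its point
(`negName_treeSet`, `posName_treeSet`). Longer words are nearer to the origin, so a projection point
of the origin is a limit of ever longer words, and the gaps between octal expansions make it
determine a path (`exists_nearWord`, `exists_path_of_projPoint`). The bits are read off a Cauchy
name by search (`seenBit_spec`, `exists_seenBit`).

Both reductions fit `strongWeihrauchLE_of_initSeg`, which leaves only primitive recursive predicates
of finite initial segments to be checked. -/

theorem OracleProgram.of_eq {Φ Ψ : Baire → ℕ →. ℕ} (hΦ : OracleProgram Φ)
    (h : ∀ p n, Φ p n = Ψ p n) : OracleProgram Ψ := by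
  have : Φ = Ψ := by
    funext p n
    exact h p n
  exact this ▸ hΦ

/-- Total functionals computed by an oracle program. -/
def OracleTotal (f : Baire → ℕ → ℕ) : Prop :=
  OracleProgram fun p n => Part.some (f p n)

namespace OracleTotal

theorem of_eq {f g : Baire → ℕ → ℕ} (hf : OracleTotal f) (h : ∀ p n, f p n = g p n) :
    OracleTotal g :=
  OracleProgram.of_eq hf fun p n => by rw [h]

theorem comp {f g : Baire → ℕ → ℕ} (hf : OracleTotal f) (hg : OracleTotal g) :
    OracleTotal fun p n => f p (g p n) :=
  OracleProgram.of_eq (OracleProgram.comp hf hg) fun p n => by simp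

theorem pair {f g : Baire → ℕ → ℕ} (hf : OracleTotal f) (hg : OracleTotal g) :
    OracleTotal fun p n => Nat.pair (f p n) (g p n) :=
  OracleProgram.of_eq (OracleProgram.pair hf hg) fun p n => by simp [Seq.seq]

theorem prec {f g : Baire → ℕ → ℕ} (hf : OracleTotal f) (hg : OracleTotal g) :
    OracleTotal fun p => Nat.unpaired fun a n =>
      n.rec (f p a) fun y IH => g p (Nat.pair a (Nat.pair y IH)) := by
  refine OracleProgram.of_eq (OracleProgram.prec hf hg) fun p n => ?_
  simp only [Nat.unpaired]
  induction n.unpair.2 with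
  | zero => rfl
  | succ m ih =>
    simp only [ih]
    exact Part.bind_some _ _

theorem of_natPrimrec {f : ℕ → ℕ} (hf : Nat.Primrec f) : OracleTotal fun _ => f := by
  induction hf with
  | zero => exact OracleProgram.zero
  | succ => exact OracleProgram.succ
  | left => exact OracleProgram.left
  | right => exact OracleProgram.right
  | pair _ _ hf hg => exact hf.pair hg
  | comp _ _ hf hg => exact hf.comp hg
  | prec _ _ hf hg => exact hf.prec hg

theorem of_primrec {f : ℕ → ℕ} (hf : Primrec f) : OracleTotal fun _ => f :=
  of_natPrimrec (Primrec.nat_iff.1 hf)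

end OracleTotal

/-- The initial segment of length `s`. -/
def initSeg {α : Type} (p : ℕ → α) (s : ℕ) : List α := (List.range s).map p

@[simp] theorem length_initSeg {α : Type} (p : ℕ → α) (s : ℕ) : (initSeg p s).length = s := by
  simp [initSeg]

theorem initSeg_succ {α : Type} (p : ℕ → α) (s : ℕ) : initSeg p (s + 1) = initSeg p s ++ [p s] := by
  simp [initSeg, List.range_succ]

theorem getElem?_initSeg {α : Type} {p : ℕ → α} {s i : ℕ} (h : i < s) :
    (initSeg p s)[i]? = some (p i) := by
  simp [initSeg, h]

theorem getElem?_initSeg_eq_some {α : Type} {p : ℕ → α} {s i : ℕ} {v : α} :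
    (initSeg p s)[i]? = some v ↔ i < s ∧ p i = v := by
  by_cases h : i < s
  · rw [getElem?_initSeg h]
    simp [h]
  · simp [initSeg, h]

theorem getD_initSeg {p : Baire} {s i d : ℕ} (h : i < s) : (initSeg p s).getD i d = p i := by
  simp [List.getD, getElem?_initSeg h]

/-- The list with the given code. -/
def listOfCode (m : ℕ) : List ℕ := (Encodable.decode m).getD []

theorem primrec_listOfCode : Primrec listOfCode :=
  Primrec.option_getD.comp Primrec.decode (Primrec.const [])

@[simp] theorem listOfCode_encode (l : List ℕ) : listOfCode (Encodable.encode l) = l := by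
  simp [listOfCode]

/-- All oracle queries are collected here, by a primitive recursion that appends one queried value
per step to a coded list. Everything else is ordinary primitive recursion on lists. -/
theorem oracleTotal_initSeg : OracleTotal fun p s => Encodable.encode (initSeg p s) := by
  have hstep : Primrec fun m : ℕ =>
      Encodable.encode (listOfCode m.unpair.1 ++ [m.unpair.2]) :=
    Primrec.encode.comp (Primrec.list_concat.comp
      (primrec_listOfCode.comp (Primrec.fst.comp Primrec.unpair))
      (Primrec.snd.comp Primrec.unpair))
  have hinner : Primrec fun m : ℕ => m.unpair.2.unpair.2 :=
    Primrec.snd.comp (Primrec.unpair.comp (Primrec.snd.comp Primrec.unpair))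
  have hindex : Primrec fun m : ℕ => m.unpair.2.unpair.1 :=
    Primrec.fst.comp (Primrec.unpair.comp (Primrec.snd.comp Primrec.unpair))
  have horacle : OracleTotal fun p n => p n := OracleProgram.oracle
  have h := (OracleTotal.prec
    (OracleTotal.of_primrec (Primrec.const (Encodable.encode ([] : List ℕ))))
    ((OracleTotal.of_primrec hstep).comp
      ((OracleTotal.of_primrec hinner).pair (horacle.comp (OracleTotal.of_primrec hindex))))).comp
    (OracleTotal.of_primrec (Primrec₂.natPair.comp (Primrec.const 0) Primrec.id))
  refine h.of_eq fun p s => ?_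
  simp only [Nat.unpaired, Nat.unpair_pair, id]
  induction s with
  | zero => simp [initSeg]
  | succ s ih => simp only [ih, initSeg_succ, listOfCode_encode]

/-- A total functional that computes the entry `n` by a primitive recursive function from an
initial segment of the oracle, of primitive recursive length. -/
theorem oracleTotal_of_initSeg {g : ℕ → List ℕ → ℕ} (hg : Primrec₂ g) {h : ℕ → ℕ}
    (hh : Primrec h) : OracleTotal fun p n => g n (initSeg p (h n)) := by
  have hg' : Primrec fun m : ℕ => g m.unpair.1 (listOfCode m.unpair.2) :=
    hg.comp (Primrec.fst.comp Primrec.unpair)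
      (primrec_listOfCode.comp (Primrec.snd.comp Primrec.unpair))
  refine ((OracleTotal.of_primrec hg').comp ((OracleTotal.of_primrec Primrec.id).pair
    (oracleTotal_initSeg.comp (OracleTotal.of_primrec hh)))).of_eq fun p n => ?_
  simp

open Classical in
/-- The least stage at which a test of an initial segment of the oracle succeeds codes the
output. -/
def searchProgram (test : ℕ → ℕ → List ℕ → Prop) (p : Baire) (n : ℕ) : Part ℕ :=
  (Nat.rfind fun s => Part.some (decide (test n s (initSeg p s)))).map fun s => s.unpair.1

theorem oracleProgram_search {test : ℕ → ℕ → List ℕ → Prop}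
    (h : PrimrecPred fun a : ℕ × ℕ × List ℕ => test a.1 a.2.1 a.2.2) :
    OracleProgram (searchProgram test) := by
  classical
  -- The value 0 stands for success, because `rfind` searches for a zero.
  have hd : Primrec fun m : ℕ => if test m.unpair.1.unpair.1 m.unpair.1.unpair.2
      (listOfCode m.unpair.2) then 0 else 1 := by
    have h1 : Primrec fun m : ℕ => (m.unpair.1.unpair.1, m.unpair.1.unpair.2,
        listOfCode m.unpair.2) :=
      .pair (Primrec.fst.comp (Primrec.unpair.comp (Primrec.fst.comp Primrec.unpair)))
        (.pair (Primrec.snd.comp (Primrec.unpair.comp (Primrec.fst.comp Primrec.unpair)))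
          (primrec_listOfCode.comp (Primrec.snd.comp Primrec.unpair)))
    exact Primrec.ite (PrimrecPred.comp h h1) (Primrec.const 0) (Primrec.const 1)
  have htest := (OracleTotal.of_primrec hd).comp ((OracleTotal.of_primrec Primrec.id).pair
    (oracleTotal_initSeg.comp (OracleTotal.of_primrec (Primrec.snd.comp Primrec.unpair))))
  refine (OracleProgram.comp OracleProgram.left (OracleProgram.rfind htest)).of_eq fun p n => ?_
  simp only [Nat.unpair_pair, id, listOfCode_encode, searchProgram]
  have : (fun s => (fun m => decide (m = 0)) <$> Part.some
      (if test n s (initSeg p s) then 0 else 1)) =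
      fun s => (Part.some (decide (test n s (initSeg p s))) : Part Bool) := by
    funext s
    by_cases ht : test n s (initSeg p s) <;> simp [ht]
  rw [this]
  exact Part.bind_some_eq_map _ _

theorem mem_searchProgram {test : ℕ → ℕ → List ℕ → Prop} {p : Baire} {n v : ℕ}
    (h : v ∈ searchProgram test p n) : ∃ s, test n s (initSeg p s) ∧ s.unpair.1 = v := by
  obtain ⟨s, hs, hv⟩ := (Part.mem_map_iff _).1 h
  exact ⟨s, by simpa using Nat.rfind_spec hs, hv⟩

theorem searchProgram_dom {test : ℕ → ℕ → List ℕ → Prop} {p : Baire} {n : ℕ}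
    (h : ∃ s, test n s (initSeg p s)) : ∃ v, v ∈ searchProgram test p n := by
  classical
  have : (Nat.rfind fun s => Part.some (decide (test n s (initSeg p s)))).Dom := by
    obtain ⟨s, hs⟩ := h
    exact Nat.rfind_dom.2 ⟨s, by simpa using hs, fun _ => trivial⟩
  exact ⟨_, Part.mem_map _ (Part.get_mem this)⟩

/-- The partial function on Baire space with the entries computed by `Φ`. -/
def functional (Φ : Baire → ℕ →. ℕ) : Baire →. Baire := fun p =>
  ⟨∀ n, (Φ p n).Dom, fun h n => (Φ p n).get (h n)⟩

theorem mem_functional {Φ : Baire → ℕ →. ℕ} {p q : Baire} :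
    q ∈ functional Φ p ↔ ∀ n, q n ∈ Φ p n := by
  constructor
  · rintro ⟨h, rfl⟩ n
    exact Part.get_mem _
  · intro h
    exact ⟨fun n => (h n).fst, funext fun n => (h n).snd⟩

theorem computableOnBaire_functional {Φ : Baire → ℕ →. ℕ} (h : OracleProgram Φ) :
    ComputableOnBaire (functional Φ) :=
  ⟨Φ, h, fun _ _ => mem_functional⟩

/-- A criterion for strong reducibility: the inputs are translated by a primitive recursive
function of initial segments, the outputs by a search. -/
theorem strongWeihrauchLE_of_initSeg {f g : Problem} {pre : ℕ → List ℕ → ℕ} {len : ℕ → ℕ}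
    {test : ℕ → ℕ → List ℕ → Prop} (hpre : Primrec₂ pre) (hlen : Primrec len)
    (htest : PrimrecPred fun a : ℕ × ℕ × List ℕ => test a.1 a.2.1 a.2.2)
    (h : ∀ p x, f.repIn.IsName p x → x ∈ f.fn.dom →
      ∃ x' ∈ g.fn.dom, g.repIn.IsName (fun n => pre n (initSeg p (len n))) x' ∧
        ∀ q, ∀ y' ∈ g.fn.val x', g.repOut.IsName q y' →
          (∀ n, ∃ s, test n s (initSeg q s)) ∧
          ∀ r : Baire, (∀ n, ∃ s, test n s (initSeg q s) ∧ s.unpair.1 = r n) →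
            ∃ y ∈ f.fn.val x, f.repOut.IsName r y) :
    StrongWeihrauchLE f g := by
  refine ⟨functional fun p n => Part.some (pre n (initSeg p (len n))),
    functional (searchProgram test),
    computableOnBaire_functional (oracleTotal_of_initSeg hpre hlen),
    computableOnBaire_functional (oracleProgram_search htest), fun G hG p x hp hx => ?_⟩
  obtain ⟨x', hx', hname, hout⟩ := h p x hp hx
  obtain ⟨q, hq, y', hy', hqy⟩ := hG _ x' hname hx'
  obtain ⟨hdef, hval⟩ := hout q y' hy' hqy
  choose r hr using fun n => searchProgram_dom (hdef n)
  obtain ⟨y, hy, hry⟩ := hval r fun n => mem_searchProgram (hr n)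
  refine ⟨r, ?_, y, hy, hry⟩
  exact Part.mem_bind (Part.mem_bind (mem_functional.2 fun n => Part.mem_some _) hq)
    (mem_functional.2 hr)

/-! ### Primitive recursive functions with rational values -/

/-- Rational valued functions with primitive recursive numerators and denominators. -/
def RatPrimrec {α : Type} [Primcodable α] (f : α → ℚ) : Prop :=
  ∃ a b c : α → ℕ, Primrec a ∧ Primrec b ∧ Primrec c ∧
    ∀ x, f x = ((a x : ℚ) - b x) / (c x + 1)

theorem primrec_natPow : Primrec₂ ((· ^ ·) : ℕ → ℕ → ℕ) :=
  Primrec₂.unpaired'.1 Nat.Primrec.pow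

theorem primrecPred_imp {α : Type} [Primcodable α] {p q : α → Prop} (hp : PrimrecPred p)
    (hq : PrimrecPred q) : PrimrecPred fun x => p x → q x :=
  (hp.not.or hq).of_eq fun _ => imp_iff_not_or.symm

/-- Bounded quantification over a primitive recursive bound. -/
theorem primrecPred_forall_lt {α : Type} [Primcodable α] {b : α → ℕ} {p : ℕ → α → Prop}
    (hb : Primrec b) (hp : PrimrecPred fun z : ℕ × α => p z.1 z.2) :
    PrimrecPred fun x => ∀ i < b x, p i x := by
  have h : PrimrecRel fun (L : List ℕ) (x : α) => ∀ i ∈ L, p i x :=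
    PrimrecRel.forall_mem_list hp
  exact (h.comp (Primrec.list_range.comp hb) Primrec.id).of_eq fun x => by simp

theorem primrec_unpair_fst {α : Type} [Primcodable α] {f : α → ℕ} (hf : Primrec f) :
    Primrec fun x => (f x).unpair.1 :=
  Primrec.fst.comp (Primrec.unpair.comp hf)

theorem primrec_unpair_snd {α : Type} [Primcodable α] {f : α → ℕ} (hf : Primrec f) :
    Primrec fun x => (f x).unpair.2 :=
  Primrec.snd.comp (Primrec.unpair.comp hf)

namespace RatPrimrec

variable {α : Type} [Primcodable α] {f g : α → ℚ}

theorem of_eq (hf : RatPrimrec f) (h : ∀ x, f x = g x) : RatPrimrec g := by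
  obtain ⟨a, b, c, ha, hb, hc, hf⟩ := hf
  exact ⟨a, b, c, ha, hb, hc, fun x => by rw [← h, hf]⟩

theorem div_nat {u v : α → ℕ} (hu : Primrec u) (hv : Primrec v) (hpos : ∀ x, 0 < v x) :
    RatPrimrec fun x => (u x : ℚ) / v x := by
  refine ⟨u, fun _ => 0, fun x => v x - 1, hu, Primrec.const 0,
    Primrec.nat_sub.comp hv (Primrec.const 1), fun x => ?_⟩
  rw [Nat.cast_sub (hpos x)]
  simp

theorem natCast {u : α → ℕ} (hu : Primrec u) : RatPrimrec fun x => (u x : ℚ) :=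
  (div_nat hu (Primrec.const 1) fun _ => one_pos).of_eq fun x => by simp

theorem natConst (k : ℕ) : RatPrimrec fun _ : α => (k : ℚ) := natCast (Primrec.const k)

theorem inv_pow {u : α → ℕ} (hu : Primrec u) {b : ℕ} (hb : 0 < b) :
    RatPrimrec fun x => ((b : ℚ)⁻¹) ^ u x :=
  (div_nat (Primrec.const 1) (primrec_natPow.comp (Primrec.const b) hu)
    fun x => Nat.pow_pos hb).of_eq fun x => by simp

theorem ratNum {u : α → ℕ} (hu : Primrec u) : RatPrimrec fun x => ratNum (u x) :=
  ⟨_, _, _, primrec_unpair_fst (primrec_unpair_fst hu), primrec_unpair_snd (primrec_unpair_fst hu),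
    primrec_unpair_snd hu, fun _ => rfl⟩

theorem nonnegRatNum {u : α → ℕ} (hu : Primrec u) : RatPrimrec fun x => nonnegRatNum (u x) :=
  ⟨_, _, _, primrec_unpair_fst hu, Primrec.const 0, primrec_unpair_snd hu,
    fun _ => by simp [Wei.nonnegRatNum]⟩

theorem add (hf : RatPrimrec f) (hg : RatPrimrec g) : RatPrimrec fun x => f x + g x := by
  obtain ⟨a, b, c, ha, hb, hc, hf⟩ := hf
  obtain ⟨a', b', c', ha', hb', hc', hg⟩ := hg
  have hs := Primrec.succ.comp hc
  have hs' := Primrec.succ.comp hc'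
  refine ⟨fun x => a x * (c' x).succ + a' x * (c x).succ,
    fun x => b x * (c' x).succ + b' x * (c x).succ, fun x => (c x).succ * (c' x).succ - 1,
    Primrec.nat_add.comp (Primrec.nat_mul.comp ha hs') (Primrec.nat_mul.comp ha' hs),
    Primrec.nat_add.comp (Primrec.nat_mul.comp hb hs') (Primrec.nat_mul.comp hb' hs),
    Primrec.nat_sub.comp (Primrec.nat_mul.comp hs hs') (Primrec.const 1), fun x => ?_⟩
  have h1 : 1 ≤ (c x).succ * (c' x).succ := Nat.mul_pos (Nat.succ_pos _) (Nat.succ_pos _)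
  have h2 : (c x : ℚ) + 1 ≠ 0 := by positivity
  have h3 : (c' x : ℚ) + 1 ≠ 0 := by positivity
  beta_reduce
  rw [hf, hg, Nat.cast_sub h1]
  push_cast
  rw [sub_add_cancel]
  field_simp
  ring

theorem neg (hf : RatPrimrec f) : RatPrimrec fun x => -f x := by
  obtain ⟨a, b, c, ha, hb, hc, hf⟩ := hf
  exact ⟨b, a, c, hb, ha, hc, fun x => by
    beta_reduce
    rw [hf, ← neg_div, neg_sub]⟩

theorem sub (hf : RatPrimrec f) (hg : RatPrimrec g) : RatPrimrec fun x => f x - g x :=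
  (hf.add hg.neg).of_eq fun x => by ring

theorem mul (hf : RatPrimrec f) (hg : RatPrimrec g) : RatPrimrec fun x => f x * g x := by
  obtain ⟨a, b, c, ha, hb, hc, hf⟩ := hf
  obtain ⟨a', b', c', ha', hb', hc', hg⟩ := hg
  have hs := Primrec.succ.comp hc
  have hs' := Primrec.succ.comp hc'
  refine ⟨fun x => a x * a' x + b x * b' x, fun x => a x * b' x + b x * a' x,
    fun x => (c x).succ * (c' x).succ - 1,
    Primrec.nat_add.comp (Primrec.nat_mul.comp ha ha') (Primrec.nat_mul.comp hb hb'),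
    Primrec.nat_add.comp (Primrec.nat_mul.comp ha hb') (Primrec.nat_mul.comp hb ha'),
    Primrec.nat_sub.comp (Primrec.nat_mul.comp hs hs') (Primrec.const 1), fun x => ?_⟩
  have h1 : 1 ≤ (c x).succ * (c' x).succ := Nat.mul_pos (Nat.succ_pos _) (Nat.succ_pos _)
  have h2 : (c x : ℚ) + 1 ≠ 0 := by positivity
  have h3 : (c' x : ℚ) + 1 ≠ 0 := by positivity
  beta_reduce
  rw [hf, hg, Nat.cast_sub h1]
  push_cast
  rw [sub_add_cancel]
  field_simp
  ring

theorem sq (hf : RatPrimrec f) : RatPrimrec fun x => f x ^ 2 :=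
  (hf.mul hf).of_eq fun x => by ring

theorem sum (m : ℕ) {F : ℕ → α → ℚ} (hF : ∀ i, RatPrimrec (F i)) :
    RatPrimrec fun x => ∑ i ∈ Finset.range m, F i x := by
  induction m with
  | zero => exact (natConst 0).of_eq fun x => by simp
  | succ m ih => exact (ih.add (hF m)).of_eq fun x => by rw [Finset.sum_range_succ]

theorem pos (hf : RatPrimrec f) : PrimrecPred fun x => 0 < f x := by
  obtain ⟨a, b, c, ha, hb, hc, hf⟩ := hf
  refine (Primrec.nat_lt.comp hb ha).of_eq fun x => ?_
  have : (0 : ℚ) < c x + 1 := by positivity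
  rw [hf, div_pos_iff_of_pos_right this, sub_pos, Nat.cast_lt]

theorem lt (hf : RatPrimrec f) (hg : RatPrimrec g) : PrimrecPred fun x => f x < g x :=
  (hg.sub hf).pos.of_eq fun _ => sub_pos

theorem le (hf : RatPrimrec f) (hg : RatPrimrec g) : PrimrecPred fun x => f x ≤ g x :=
  (hg.lt hf).not.of_eq fun _ => not_lt

end RatPrimrec

/-! ### Distances between rational points -/

/-- The rational point with the coordinates `v i`. -/
def toEuc (n : ℕ) (v : ℕ → ℚ) : Euc n := WithLp.toLp 2 fun i => ((v i : ℚ) : ℝ)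

theorem ratPoint_eq_toEuc (n k : ℕ) : ratPoint n k = toEuc n fun i => ratNum (entry i k) := rfl

/-- The square of the distance of two rational points. -/
def sqDist (n : ℕ) (v w : ℕ → ℚ) : ℚ := ∑ i ∈ Finset.range n, (v i - w i) ^ 2

theorem dist_toEuc_sq (n : ℕ) (v w : ℕ → ℚ) :
    dist (toEuc n v) (toEuc n w) ^ 2 = (sqDist n v w : ℝ) := by
  rw [EuclideanSpace.dist_eq, Real.sq_sqrt (Finset.sum_nonneg fun _ _ => sq_nonneg _)]
  simp only [toEuc, sqDist, Rat.cast_sum, Rat.cast_pow, Rat.cast_sub, Real.dist_eq, sq_abs]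
  rw [Finset.sum_range]

/-- The distance is the square root of a rational number, so comparing it with a rational is
decidable by squaring. A comparison involving two distances is not of this form; this is why
`NearestOK` interposes a rational bound. -/
theorem dist_toEuc_lt_iff {n : ℕ} {v w : ℕ → ℚ} {r : ℚ} :
    dist (toEuc n v) (toEuc n w) < r ↔ 0 < r ∧ sqDist n v w < r ^ 2 := by
  have h0 : 0 ≤ dist (toEuc n v) (toEuc n w) := dist_nonneg
  rw [← Rat.cast_lt (K := ℝ), ← Rat.cast_lt (K := ℝ), ← dist_toEuc_sq, Rat.cast_zero, Rat.cast_pow]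
  constructor
  · intro h
    exact ⟨h0.trans_lt h, pow_lt_pow_left₀ h h0 two_ne_zero⟩
  · rintro ⟨hr, h⟩
    exact lt_of_pow_lt_pow_left₀ 2 hr.le h

theorem dist_toEuc_le_iff {n : ℕ} {v w : ℕ → ℚ} {r : ℚ} :
    dist (toEuc n v) (toEuc n w) ≤ r ↔ 0 ≤ r ∧ sqDist n v w ≤ r ^ 2 := by
  have h0 : 0 ≤ dist (toEuc n v) (toEuc n w) := dist_nonneg
  rw [← Rat.cast_le (K := ℝ), ← Rat.cast_le (K := ℝ), ← dist_toEuc_sq, Rat.cast_zero, Rat.cast_pow]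
  constructor
  · intro h
    exact ⟨h0.trans h, pow_le_pow_left₀ h0 h 2⟩
  · rintro ⟨hr, h⟩
    exact le_of_sq_le_sq h hr

section

variable {α : Type} [Primcodable α] {n : ℕ} {v w : ℕ → α → ℚ} {r : α → ℚ}

theorem ratPrimrec_sqDist (hv : ∀ i, RatPrimrec (v i)) (hw : ∀ i, RatPrimrec (w i)) :
    RatPrimrec fun x => sqDist n (fun i => v i x) (fun i => w i x) :=
  RatPrimrec.sum n fun i => ((hv i).sub (hw i)).sq

theorem primrecPred_dist_lt (hv : ∀ i, RatPrimrec (v i)) (hw : ∀ i, RatPrimrec (w i))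
    (hr : RatPrimrec r) :
    PrimrecPred fun x => dist (toEuc n fun i => v i x) (toEuc n fun i => w i x) < r x :=
  (hr.pos.and ((ratPrimrec_sqDist hv hw).lt hr.sq)).of_eq fun _ => dist_toEuc_lt_iff.symm

theorem primrecPred_dist_le (hv : ∀ i, RatPrimrec (v i)) (hw : ∀ i, RatPrimrec (w i))
    (hr : RatPrimrec r) :
    PrimrecPred fun x => dist (toEuc n fun i => v i x) (toEuc n fun i => w i x) ≤ r x :=
  ((RatPrimrec.le ((RatPrimrec.natConst 0).of_eq fun _ => Nat.cast_zero) hr).and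
    ((ratPrimrec_sqDist hv hw).le hr.sq)).of_eq fun _ => dist_toEuc_le_iff.symm

theorem primrec_entry (i : ℕ) {u : α → ℕ} (hu : Primrec u) : Primrec fun x => entry i (u x) := by
  induction i generalizing u with
  | zero => exact primrec_unpair_fst hu
  | succ i ih => exact ih (primrec_unpair_snd hu)

theorem ratPrimrec_coord {u : α → ℕ} (hu : Primrec u) (i : ℕ) :
    RatPrimrec fun x => ratNum (entry i (u x)) :=
  RatPrimrec.ratNum (primrec_entry i hu)

end

theorem dist_cauchyName_le {n : ℕ} {q : Baire} {y : Euc n} (h : (cauchyRep n).IsName q y) (i : ℕ) :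
    dist (ratPoint n (q i)) y ≤ (2 : ℝ)⁻¹ ^ i :=
  le_of_tendsto (tendsto_const_nhds.dist h.2) (eventually_atTop.2 ⟨i, fun j hj => by
    simpa using h.1 i j hj⟩)

theorem exists_inv_pow_lt {ε : ℝ} (hε : 0 < ε) : ∃ i : ℕ, (2 : ℝ)⁻¹ ^ i < ε :=
  exists_pow_lt_of_lt_one hε (by norm_num)

/-! ### Bounds for the codes of approximations -/

theorem pair_le_pair {a b c d : ℕ} (h : a ≤ c) (h' : b ≤ d) : Nat.pair a b ≤ Nat.pair c d :=
  ((StrictMono.monotone fun _ _ h => Nat.pair_lt_pair_left b h) h).trans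
    ((StrictMono.monotone fun _ _ h => Nat.pair_lt_pair_right c h) h')

theorem entry_le (i k : ℕ) : entry i k ≤ k := by
  induction i generalizing k with
  | zero => exact Nat.unpair_left_le k
  | succ i ih => exact (ih _).trans (Nat.unpair_right_le k)

theorem abs_ratNum_le (k : ℕ) : |ratNum k| ≤ k := by
  have h1 : (k.unpair.1.unpair.1 : ℚ) ≤ k := by
    exact_mod_cast (Nat.unpair_left_le _).trans (Nat.unpair_left_le _)
  have h2 : (k.unpair.1.unpair.2 : ℚ) ≤ k := by
    exact_mod_cast (Nat.unpair_right_le _).trans (Nat.unpair_left_le _)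
  have h3 : (1 : ℚ) ≤ k.unpair.2 + 1 := by simp
  have h4 : (0 : ℚ) ≤ k.unpair.1.unpair.1 := Nat.cast_nonneg _
  have h5 : (0 : ℚ) ≤ k.unpair.1.unpair.2 := Nat.cast_nonneg _
  rw [ratNum, abs_div, abs_of_pos (by linarith : (0 : ℚ) < k.unpair.2 + 1)]
  exact (div_le_self (abs_nonneg _) h3).trans (abs_le.2 ⟨by linarith, by linarith⟩)

theorem nonnegRatNum_le (k : ℕ) : nonnegRatNum k ≤ k := by
  have h1 : (k.unpair.1 : ℚ) ≤ k := by exact_mod_cast Nat.unpair_left_le _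
  exact (div_le_self (Nat.cast_nonneg _) (by simp)).trans h1

theorem norm_le_sum_abs {n : ℕ} (x : Euc n) : ‖x‖ ≤ ∑ i, |x i| := by
  rw [EuclideanSpace.norm_eq]
  refine Real.sqrt_le_iff.2 ⟨Finset.sum_nonneg fun _ _ => abs_nonneg _, ?_⟩
  exact Finset.sum_sq_le_sq_sum_of_nonneg fun _ _ => norm_nonneg _

theorem abs_coord_le_norm {n : ℕ} (x : Euc n) (i : Fin n) : |x i| ≤ ‖x‖ :=
  PiLp.norm_apply_le x i

theorem norm_ratPoint_le (n k : ℕ) : ‖ratPoint n k‖ ≤ n * k := by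
  refine (norm_le_sum_abs _).trans ((Finset.sum_le_card_nsmul _ _ (k : ℝ) fun i _ => ?_).trans ?_)
  · have h1 := abs_ratNum_le (entry i k)
    have h2 : ((entry i k : ℕ) : ℚ) ≤ k := by exact_mod_cast entry_le i k
    have h3 := h1.trans h2
    change |((ratNum (entry i k) : ℚ) : ℝ)| ≤ k
    exact_mod_cast h3
  · simp

/-- A bound for the codes of the sequences of length `n` with entries at most `C`. -/
def seqCodeBound : ℕ → ℕ → ℕ
  | 0, _ => 0
  | n + 1, C => Nat.pair C (seqCodeBound n C)

theorem primrec_seqCodeBound (n : ℕ) : Primrec (seqCodeBound n) := by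
  induction n with
  | zero => exact Primrec.const 0
  | succ n ih => exact Primrec₂.natPair.comp Primrec.id ih

theorem exists_entry_eq (n C : ℕ) : ∀ v : ℕ → ℕ, (∀ i < n, v i ≤ C) →
    ∃ k ≤ seqCodeBound n C, ∀ i < n, entry i k = v i := by
  induction n with
  | zero => exact fun v _ => ⟨0, le_rfl, fun i hi => absurd hi (Nat.not_lt_zero i)⟩
  | succ n ih =>
    intro v hv
    obtain ⟨k, hkb, hk⟩ := ih (fun i => v (i + 1)) fun i hi => hv _ (by omega)
    refine ⟨Nat.pair (v 0) k, pair_le_pair (hv 0 (by omega)) hkb, fun i hi => ?_⟩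
    cases i with
    | zero => simp [entry]
    | succ i => simpa [entry] using hk i (by omega)

/-- Rounding `t` down to a multiple of `1 / N` leaves a numerator of absolute value at most `M * N +
1`, and the pairing function is monotone. -/
theorem exists_ratNum_near {M N : ℕ} (hN : 0 < N) {t : ℝ} (ht : |t| ≤ M) :
    ∃ k ≤ Nat.pair (Nat.pair (M * N + 1) (M * N + 1)) N, |((ratNum k : ℚ) : ℝ) - t| ≤ 1 / N := by
  have hN' : (0 : ℝ) < N := by exact_mod_cast hN
  obtain ⟨h1, h2⟩ := abs_le.1 ht
  have hub : ⌊t * N⌋ ≤ (M * N : ℤ) := by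
    have : (⌊t * N⌋ : ℝ) ≤ M * N := (Int.floor_le _).trans (by gcongr)
    exact_mod_cast this
  have hlb : -(M * N + 1 : ℤ) ≤ ⌊t * N⌋ := by
    refine Int.le_floor.2 ?_
    have : -(M : ℝ) * N ≤ t * N := by gcongr
    push_cast
    linarith
  refine ⟨Nat.pair (Nat.pair (⌊t * N⌋).toNat (-⌊t * N⌋).toNat) (N - 1),
    pair_le_pair (pair_le_pair ?_ ?_) (by omega), ?_⟩
  · rw [Int.toNat_le]
    push_cast
    linarith
  · rw [Int.toNat_le]
    push_cast
    linarith
  · have h3 : (((⌊t * N⌋).toNat : ℝ) - ((-⌊t * N⌋).toNat : ℝ)) = (⌊t * N⌋ : ℝ) := by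
      exact_mod_cast congrArg (Int.cast (R := ℝ)) (show (((⌊t * N⌋).toNat : ℤ) -
        ((-⌊t * N⌋).toNat : ℤ)) = ⌊t * N⌋ by omega)
    have h4 : (((N - 1 : ℕ) : ℝ) + 1) = N := by exact_mod_cast (show N - 1 + 1 = N by omega)
    have h5 : ((⌊t * N⌋ : ℝ) / N - t) = (⌊t * N⌋ - t * N) / N := by field_simp
    simp only [ratNum, Nat.unpair_pair]
    push_cast
    rw [h3, h4, h5, abs_div, abs_of_pos hN']
    gcongr
    rw [abs_le]
    constructor <;> linarith [Int.floor_le (t * N), Int.lt_floor_add_one (t * N)]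

theorem exists_ratPoint_near {n M N : ℕ} (hN : 0 < N) {y : Euc n} (hy : ∀ i, |y i| ≤ M) :
    ∃ k ≤ seqCodeBound n (Nat.pair (Nat.pair (M * N + 1) (M * N + 1)) N),
      dist (ratPoint n k) y ≤ n / N := by
  choose c hcb hc using fun i => exists_ratNum_near hN (hy i)
  obtain ⟨k, hkb, hk⟩ := exists_entry_eq n _ (fun i => if h : i < n then c ⟨i, h⟩ else 0)
    fun i hi => by simpa [hi] using hcb ⟨i, hi⟩
  refine ⟨k, hkb, ?_⟩
  rw [dist_eq_norm]
  refine (norm_le_sum_abs _).trans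
    ((Finset.sum_le_card_nsmul _ _ (1 / N : ℝ) fun i _ => ?_).trans ?_)
  · have : (ratPoint n k - y) i = ((ratNum (c i) : ℚ) : ℝ) - y i := by
      simp [ratPoint, hk i i.2]
    rw [this]
    exact hc i
  · simp [div_eq_mul_inv]

/-- A strict bound for the codes of approximations with precision `2⁻¹ ^ (i + 1)`, in terms of the
codes of an approximation of the point and of a ball that meets the set. -/
def codeBound (n c c' i : ℕ) : ℕ :=
  seqCodeBound n (Nat.pair (Nat.pair
    ((2 * n * c + (n + 1) * c' + 2) * ((n + 1) * 2 ^ (i + 1)) + 1)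
    ((2 * n * c + (n + 1) * c' + 2) * ((n + 1) * 2 ^ (i + 1)) + 1)) ((n + 1) * 2 ^ (i + 1))) + 1

theorem primrec_codeBound {α : Type} [Primcodable α] (n : ℕ) {c c' i : α → ℕ} (hc : Primrec c)
    (hc' : Primrec c') (hi : Primrec i) : Primrec fun x => codeBound n (c x) (c' x) (i x) := by
  have hN : Primrec fun x => (n + 1) * 2 ^ (i x + 1) :=
    Primrec.nat_mul.comp (Primrec.const _)
      (primrec_natPow.comp (Primrec.const 2) (Primrec.succ.comp hi))
  have hM : Primrec fun x => 2 * n * c x + (n + 1) * c' x + 2 :=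
    Primrec.nat_add.comp (Primrec.nat_add.comp (Primrec.nat_mul.comp (Primrec.const _) hc)
      (Primrec.nat_mul.comp (Primrec.const _) hc')) (Primrec.const 2)
  have hV := Primrec.succ.comp (Primrec.nat_mul.comp hM hN)
  exact Primrec.succ.comp ((primrec_seqCodeBound n).comp
    (Primrec₂.natPair.comp (Primrec₂.natPair.comp hV hV) hN))

/-- Entry `i` is rounded to half the precision `2⁻¹ ^ i`, so two entries differ by at most the
precision of the earlier one. The bounds on the codes supply the compactness that `WKL` needs. -/
theorem exists_bounded_name {n c c' : ℕ} {y : Euc n}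
    (hy : ‖y‖ ≤ (2 * n * c + (n + 1) * c' + 2 : ℕ)) :
    ∃ q : Baire, (cauchyRep n).IsName q y ∧ ∀ i, q i < codeBound n c c' i := by
  choose q hqb hq using fun i : ℕ => exists_ratPoint_near (N := (n + 1) * 2 ^ (i + 1))
    (by positivity) fun l => (abs_coord_le_norm y l).trans hy
  have hdist : ∀ i, dist (ratPoint n (q i)) y ≤ (2 : ℝ)⁻¹ ^ i / 2 := fun i => by
    refine (hq i).trans ?_
    push_cast
    rw [div_le_iff₀ (by positivity), pow_succ, inv_pow]
    have : (2 ^ i : ℝ) ≠ 0 := by positivity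
    field_simp
    linarith
  refine ⟨q, ⟨fun i j hij => ?_, ?_⟩, fun i => Nat.lt_succ_of_le (hqb i)⟩
  · have h1 := dist_triangle_right (ratPoint n (q i)) (ratPoint n (q j)) y
    have h2 : (2 : ℝ)⁻¹ ^ j ≤ (2 : ℝ)⁻¹ ^ i :=
      pow_le_pow_of_le_one (by norm_num) (by norm_num) hij
    linarith [hdist i, hdist j]
  · rw [tendsto_iff_dist_tendsto_zero]
    refine squeeze_zero (fun _ => dist_nonneg) hdist ?_
    simpa using (tendsto_pow_atTop_nhds_zero_of_lt_one (r := (2 : ℝ)⁻¹) (by norm_num)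
      (by norm_num)).div_const 2

/-- The first ball of the positive name contains some `a ∈ A`, and `y` is no farther from `x` than
`a` is. Going from 0 to `y` through the approximation `p 0` of `x` uses its norm twice and its
error, at most 1, twice. -/
theorem norm_projPoint_le {n : ℕ} {p pos : Baire} {x y : Euc n} {A : Set (Euc n)}
    (hp : (cauchyRep n).IsName p x) (hpos : PosName n pos A) (hy : y ∈ projPoints x A) :
    ‖y‖ ≤ (2 * n * p 0 + (n + 1) * pos 0 + 2 : ℕ) := by
  obtain ⟨a, hab, haA⟩ := (hpos (pos 0)).1 ⟨0, rfl⟩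
  have h1 := dist_cauchyName_le hp 0
  have h2 : dist x y ≤ dist x a := hy.2 ▸ Metric.infDist_le_dist_of_mem haA
  have h3 := norm_ratPoint_le n (p 0)
  have h4 := norm_ratPoint_le n (pos 0).unpair.1
  have h5 : ((nonnegRatNum (pos 0).unpair.2 : ℚ) : ℝ) ≤ pos 0 := by
    have h := nonnegRatNum_le (pos 0).unpair.2
    have h' : (((pos 0).unpair.2 : ℕ) : ℚ) ≤ pos 0 := by exact_mod_cast Nat.unpair_right_le _
    exact_mod_cast h.trans h'
  have h6 : (((pos 0).unpair.1 : ℕ) : ℝ) ≤ pos 0 := by exact_mod_cast Nat.unpair_left_le _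
  have h7 : (n : ℝ) * ((pos 0).unpair.1 : ℕ) ≤ n * pos 0 := by gcongr
  simp only [basicBall, Metric.mem_ball] at hab
  have h8 : dist y 0 ≤ dist y x + dist x (ratPoint n (p 0)) + dist (ratPoint n (p 0)) 0 :=
    dist_triangle4 _ _ _ _
  have h9 : dist x a ≤ dist x (ratPoint n (p 0)) + dist (ratPoint n (p 0))
    (ratPoint n (pos 0).unpair.1) + dist (ratPoint n (pos 0).unpair.1) a := dist_triangle4 _ _ _ _
  have h10 := dist_triangle_right (ratPoint n (p 0)) (ratPoint n (pos 0).unpair.1) 0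
  rw [dist_comm] at hab h1
  rw [dist_comm y x] at h8
  simp only [dist_zero_right, pow_zero] at *
  push_cast
  linarith

/-! ### Projecting with weak Kőnig's lemma -/

/-- The consistency of two guesses `⟨i, k⟩` and `⟨j, k'⟩` for the entries of a Cauchy name. -/
def CauchyOK (n a b : ℕ) : Prop :=
  a.unpair.1 ≤ b.unpair.1 →
    dist (ratPoint n a.unpair.2) (ratPoint n b.unpair.2) ≤ (2 : ℝ)⁻¹ ^ a.unpair.1

/-- The guess `⟨i, k⟩` is not seen to lie in the basic ball `c`. -/
def AvoidsOK (n a c : ℕ) : Prop :=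
  ¬ dist (ratPoint n a.unpair.2) (ratPoint n c.unpair.1) <
    ((nonnegRatNum c.unpair.2 : ℚ) : ℝ) - (2 : ℝ)⁻¹ ^ a.unpair.1

/-- The guess `⟨i, k⟩` is not seen, by means of the bound `t`, to be farther from the point with
the approximation `e` than the basic ball `c`. -/
def NearestOK (n a e c t : ℕ) : Prop :=
  ¬ (dist (ratPoint n e) (ratPoint n c.unpair.1) < ((nonnegRatNum t : ℚ) : ℝ) ∧
    ((nonnegRatNum t : ℚ) : ℝ) + ((nonnegRatNum c.unpair.2 : ℚ) : ℝ) +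
      3 * (2 : ℝ)⁻¹ ^ a.unpair.1 < dist (ratPoint n e) (ratPoint n a.unpair.2))

/-- The words that code finite parts of names of projection points: the bit with the index
`⟨i, k⟩` says whether `k` is taken for the entry `i` of the name. -/
def ProjWord (n : ℕ) (r : Baire) (w : List Bool) : Prop :=
  (∀ i < w.length, ¬ ∀ k < codeBound n (r 0) (r 3) i, w[Nat.pair i k]? = some false) ∧
  ∀ a < w.length, w[a]? = some true → ∀ s < w.length,
    (w[s]? = some true → CauchyOK n a s) ∧ AvoidsOK n a (r (4 * s + 1)) ∧
      NearestOK n a (r (2 * a.unpair.1)) (r (4 * s.unpair.1 + 3)) s.unpair.2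

/-- Every condition restricts only bits that are already present, so a shorter word has fewer
conditions to meet. -/
theorem ProjWord.of_prefix {n : ℕ} {r : Baire} {v w : List Bool} (hw : ProjWord n r w)
    (h : v <+: w) : ProjWord n r v := by
  have hlen := h.length_le
  have hget : ∀ {i b}, v[i]? = some b → w[i]? = some b := fun {i b} hi => by
    obtain ⟨u, rfl⟩ := h
    have : i < v.length := (List.getElem?_eq_some_iff.1 hi).1
    rwa [List.getElem?_append_left this]
  refine ⟨fun i hi hall => hw.1 i (hi.trans_le hlen) fun k hk => hget (hall k hk),
    fun a ha hat s hs => ?_⟩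
  obtain ⟨h1, h2⟩ := hw.2 a (ha.trans_le hlen) (hget hat) s (hs.trans_le hlen)
  exact ⟨fun hst => h1 (hget hst), h2⟩

theorem ProjWord.congr {n : ℕ} {r r' : Baire} {w : List Bool}
    (h : ∀ i < 4 * w.length + 4, r i = r' i) (hw : ProjWord n r w) : ProjWord n r' w := by
  refine ⟨fun i hi => ?_, fun a ha hat s hs => ?_⟩
  · rw [← h 0 (by omega), ← h 3 (by omega)]
    exact hw.1 i hi
  · have h1 := Nat.unpair_left_le a
    have h2 := Nat.unpair_left_le s
    rw [← h (4 * s + 1) (by omega), ← h (2 * a.unpair.1) (by omega),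
      ← h (4 * s.unpair.1 + 3) (by omega)]
    exact hw.2 a ha hat s hs

/-- The tree of the finite parts of names of projection points. -/
def projTree (n : ℕ) (r : Baire) : BinTree :=
  ⟨{w | ProjWord n r w}, fun _ hw _ hv => hw.of_prefix hv⟩

/-! ### Decidability of the tree from initial segments of the input -/

section

variable {α : Type} [Primcodable α]

theorem primrecPred_ratPoint_dist_lt (n : ℕ) {u v : α → ℕ} {r : α → ℚ} {ρ : α → ℝ}
    (hu : Primrec u) (hv : Primrec v) (hr : RatPrimrec r) (h : ∀ x, (r x : ℝ) = ρ x) :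
    PrimrecPred fun x => dist (ratPoint n (u x)) (ratPoint n (v x)) < ρ x :=
  (primrecPred_dist_lt (n := n) (ratPrimrec_coord hu) (ratPrimrec_coord hv) hr).of_eq fun x => by
    rw [ratPoint_eq_toEuc, ratPoint_eq_toEuc, h]

theorem primrecPred_ratPoint_dist_le (n : ℕ) {u v : α → ℕ} {r : α → ℚ} {ρ : α → ℝ}
    (hu : Primrec u) (hv : Primrec v) (hr : RatPrimrec r) (h : ∀ x, (r x : ℝ) = ρ x) :
    PrimrecPred fun x => dist (ratPoint n (u x)) (ratPoint n (v x)) ≤ ρ x :=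
  (primrecPred_dist_le (n := n) (ratPrimrec_coord hu) (ratPrimrec_coord hv) hr).of_eq fun x => by
    rw [ratPoint_eq_toEuc, ratPoint_eq_toEuc, h]

theorem primrecPred_cauchyOK (n : ℕ) {a b : α → ℕ} (ha : Primrec a) (hb : Primrec b) :
    PrimrecPred fun x => CauchyOK n (a x) (b x) :=
  primrecPred_imp (Primrec.nat_le.comp (primrec_unpair_fst ha) (primrec_unpair_fst hb))
    (primrecPred_ratPoint_dist_le n (primrec_unpair_snd ha) (primrec_unpair_snd hb)
      (RatPrimrec.inv_pow (primrec_unpair_fst ha) two_pos) fun x => by push_cast; rfl)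

theorem primrecPred_avoidsOK (n : ℕ) {a c : α → ℕ} (ha : Primrec a) (hc : Primrec c) :
    PrimrecPred fun x => AvoidsOK n (a x) (c x) :=
  (primrecPred_ratPoint_dist_lt n (primrec_unpair_snd ha) (primrec_unpair_fst hc)
    ((RatPrimrec.nonnegRatNum (primrec_unpair_snd hc)).sub
      (RatPrimrec.inv_pow (primrec_unpair_fst ha) two_pos)) fun x => by push_cast; rfl).not

theorem primrecPred_nearestOK (n : ℕ) {a e c t : α → ℕ} (ha : Primrec a) (he : Primrec e)
    (hc : Primrec c) (ht : Primrec t) :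
    PrimrecPred fun x => NearestOK n (a x) (e x) (c x) (t x) := by
  have h1 : PrimrecPred fun x => dist (ratPoint n (e x)) (ratPoint n (c x).unpair.1) <
      ((nonnegRatNum (t x) : ℚ) : ℝ) :=
    primrecPred_ratPoint_dist_lt n he (primrec_unpair_fst hc) (RatPrimrec.nonnegRatNum ht)
      fun x => rfl
  have h2 : PrimrecPred fun x => dist (ratPoint n (e x)) (ratPoint n (a x).unpair.2) ≤
      ((nonnegRatNum (t x) : ℚ) : ℝ) + ((nonnegRatNum (c x).unpair.2 : ℚ) : ℝ) +
        3 * (2 : ℝ)⁻¹ ^ (a x).unpair.1 :=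
    primrecPred_ratPoint_dist_le n he (primrec_unpair_snd ha)
      (((RatPrimrec.nonnegRatNum ht).add (RatPrimrec.nonnegRatNum (primrec_unpair_snd hc))).add
        ((RatPrimrec.natConst 3).mul
          (RatPrimrec.inv_pow (primrec_unpair_fst ha) two_pos))) fun x => by push_cast; rfl
  exact (h1.and h2.not).not.of_eq fun x => by rw [NearestOK, not_le]

theorem primrec_getD {l : α → List ℕ} {i : α → ℕ} (hl : Primrec l) (hi : Primrec i) :
    Primrec fun x => (l x).getD (i x) 0 :=
  (Primrec.list_getD 0).comp hl hi

theorem primrec_mul_add {i : α → ℕ} (a b : ℕ) (hi : Primrec i) : Primrec fun x => a * i x + b :=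
  Primrec.nat_add.comp (Primrec.nat_mul.comp (Primrec.const a) hi) (Primrec.const b)

theorem primrecPred_getElem? {β : Type} [Primcodable β] {w : α → List β} {i : α → ℕ} {b : α → β}
    (hw : Primrec w) (hi : Primrec i) (hb : Primrec b) :
    PrimrecPred fun x => (w x)[i x]? = some (b x) :=
  Primrec.eq.comp (Primrec.list_getElem?.comp hw hi) (Primrec.option_some.comp hb)

/-- All quantifiers are bounded by the length of the word or by a primitive recursive code bound. -/
theorem primrecPred_projWord (n : ℕ) {l : α → List ℕ} {w : α → List Bool} (hl : Primrec l)
    (hw : Primrec w) : PrimrecPred fun x => ProjWord n (fun i => (l x).getD i 0) (w x) := by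
  refine PrimrecPred.and ?_ ?_
  · refine primrecPred_forall_lt (Primrec.list_length.comp hw) (PrimrecPred.not ?_)
    refine primrecPred_forall_lt (primrec_codeBound n (primrec_getD (hl.comp .snd) (.const 0))
      (primrec_getD (hl.comp .snd) (.const 3)) .fst) ?_
    exact primrecPred_getElem? (hw.comp (Primrec.snd.comp .snd))
      (Primrec₂.natPair.comp (Primrec.fst.comp .snd) .fst) (.const false)
  · refine primrecPred_forall_lt (Primrec.list_length.comp hw) (primrecPred_imp
      (primrecPred_getElem? (hw.comp .snd) .fst (.const true)) ?_)
    have hs : Primrec fun z : ℕ × ℕ × α => z.1 := .fst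
    have ha : Primrec fun z : ℕ × ℕ × α => z.2.1 := Primrec.fst.comp .snd
    have hx : Primrec fun z : ℕ × ℕ × α => z.2.2 := Primrec.snd.comp .snd
    refine primrecPred_forall_lt (Primrec.list_length.comp (hw.comp .snd)) (PrimrecPred.and
      (primrecPred_imp (primrecPred_getElem? (hw.comp hx) hs (.const true))
        (primrecPred_cauchyOK n ha hs)) (PrimrecPred.and ?_ ?_))
    · exact primrecPred_avoidsOK n ha (primrec_getD (hl.comp hx) (primrec_mul_add 4 1 hs))
    · exact primrecPred_nearestOK n ha
        (primrec_getD (hl.comp hx) (primrec_mul_add 2 0 (primrec_unpair_fst ha)))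
        (primrec_getD (hl.comp hx) (primrec_mul_add 4 3 (primrec_unpair_fst hs)))
        (primrec_unpair_snd hs)

end

theorem primrec_word : Primrec word :=
  Primrec.option_getD.comp Primrec.decode (Primrec.const [])

/-! ### Paths of the tree and names of projection points -/

section

variable {n : ℕ} {p neg pos : Baire} {x : Euc n} {A : Set (Euc n)}

theorem join_join_zero (p neg pos : Baire) : join p (join neg pos) 0 = p 0 :=
  join_even p _ 0

theorem join_join_two_mul (p neg pos : Baire) (i : ℕ) : join p (join neg pos) (2 * i) = p i :=
  join_even p _ i

theorem join_join_neg (p neg pos : Baire) (i : ℕ) :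
    join p (join neg pos) (4 * i + 1) = neg i := by
  rw [show 4 * i + 1 = 2 * (2 * i) + 1 by ring, join_odd, join_even]

theorem join_join_pos (p neg pos : Baire) (i : ℕ) :
    join p (join neg pos) (4 * i + 3) = pos i := by
  rw [show 4 * i + 3 = 2 * (2 * i + 1) + 1 by ring, join_odd, join_odd]

/-- The bits that code the name `q`. -/
def graphBits (q : Baire) (a : ℕ) : Bool := decide (a.unpair.2 = q a.unpair.1)

theorem avoidsOK_of_name {q : Baire} {y : Euc n} (hneg : NegName n neg A)
    (hq : (cauchyRep n).IsName q y) (hy : y ∈ A) (i s : ℕ) :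
    AvoidsOK n (Nat.pair i (q i)) (neg s) := by
  intro h
  have hyc : y ∉ basicBall n (neg s) := by
    rw [hneg] at hy
    exact fun hb => hy (Set.mem_biUnion ⟨s, rfl⟩ hb)
  apply hyc
  simp only [Nat.unpair_pair] at h
  have h1 := dist_cauchyName_le hq i
  have h2 := dist_triangle_left y (ratPoint n (neg s).unpair.1) (ratPoint n (q i))
  simp only [basicBall, Metric.mem_ball]
  linarith

/-- The three error terms in `NearestOK` are the distance from `p i` to `x`, used once in each of
two polygon inequalities, and the distance from `q i` to `y`. -/
theorem nearestOK_of_name {q : Baire} {y : Euc n} (hp : (cauchyRep n).IsName p x)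
    (hpos : PosName n pos A) (hq : (cauchyRep n).IsName q y) (hy : y ∈ projPoints x A)
    (i u t : ℕ) : NearestOK n (Nat.pair i (q i)) (p i) (pos u) t := by
  rintro ⟨h1, h2⟩
  simp only [Nat.unpair_pair] at h2
  obtain ⟨a, hab, haA⟩ := (hpos (pos u)).1 ⟨u, rfl⟩
  simp only [basicBall, Metric.mem_ball] at hab
  have h3 : dist x y ≤ dist x a := hy.2 ▸ Metric.infDist_le_dist_of_mem haA
  have h4 := dist_cauchyName_le hp i
  have h5 := dist_cauchyName_le hq i
  have h6 := dist_triangle4 x (ratPoint n (p i)) (ratPoint n (pos u).unpair.1) a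
  have h7 := dist_triangle4 (ratPoint n (p i)) x y (ratPoint n (q i))
  rw [dist_comm] at hab
  rw [dist_comm x (ratPoint n (p i))] at h6
  rw [dist_comm y] at h7
  linarith

theorem graphBits_mem_paths {q : Baire} {y : Euc n} (hp : (cauchyRep n).IsName p x)
    (hneg : NegName n neg A) (hpos : PosName n pos A) (hq : (cauchyRep n).IsName q y)
    (hy : y ∈ projPoints x A) (hb : ∀ i, q i < codeBound n (p 0) (pos 0) i) :
    graphBits q ∈ paths (projTree n (join p (join neg pos))) := by
  intro m
  change ProjWord n _ (initSeg (graphBits q) m)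
  have hr3 : join p (join neg pos) 3 = pos 0 := join_join_pos p neg pos 0
  have hbit : ∀ a, graphBits q a = true → a = Nat.pair a.unpair.1 (q a.unpair.1) := fun a ha => by
    conv_lhs => rw [← Nat.pair_unpair a]
    rw [of_decide_eq_true ha]
  simp only [ProjWord, join_join_zero, hr3, length_initSeg, join_join_neg, join_join_pos,
    join_join_two_mul, getElem?_initSeg_eq_some]
  refine ⟨fun i _ hall => ?_, fun a _ ha s _ => ⟨fun hs hab => ?_, ?_, ?_⟩⟩
  · have := (hall (q i) (hb i)).2
    simp [graphBits] at this
  · rw [hbit a ha.2, hbit s hs.2]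
    simpa using hq.1 _ _ hab
  · rw [hbit a ha.2]
    exact avoidsOK_of_name hneg hq hy.1 _ _
  · have := nearestOK_of_name hp hpos hq hy a.unpair.1 s.unpair.1 s.unpair.2
    rwa [← hbit a ha.2] at this

theorem infinite_of_mem_paths {T : BinTree} {z : ℕ → Bool} (hz : z ∈ paths T) : T.1.Infinite := by
  refine Set.infinite_of_injective_forall_mem (f := fun m => initSeg z m) (fun a b h => ?_) hz
  simpa using congrArg List.length h

theorem infinite_projTree (hp : (cauchyRep n).IsName p x) (hneg : NegName n neg A)
    (hpos : PosName n pos A) (hA : IsClosed A) (hne : A.Nonempty) :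
    (projTree n (join p (join neg pos))).1.Infinite := by
  obtain ⟨y, hyA, hy⟩ := hA.exists_infDist_eq_dist hne x
  have hyp : y ∈ projPoints x A := ⟨hyA, hy.symm⟩
  obtain ⟨q, hq, hqb⟩ := exists_bounded_name (norm_projPoint_le hp hpos hyp)
  exact infinite_of_mem_paths (graphBits_mem_paths hp hneg hpos hq hyp hqb)

/-- Otherwise the initial segment long enough to decide all bits `⟨i, k⟩` below the code bound would
violate the first clause of `ProjWord`. -/
theorem exists_bit_of_mem_paths {r : Baire} {z : ℕ → Bool} (hz : z ∈ paths (projTree n r))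
    (i : ℕ) : ∃ k, z (Nat.pair i k) = true := by
  by_contra! h
  have hlt : ∀ k < codeBound n (r 0) (r 3) i,
      Nat.pair i k < Nat.pair i (codeBound n (r 0) (r 3) i) :=
    fun k hk => Nat.pair_lt_pair_right i hk
  have h1 : ProjWord n r (initSeg z (Nat.pair i (codeBound n (r 0) (r 3) i) + 1)) := hz _
  refine h1.1 i ?_ fun k hk => getElem?_initSeg_eq_some.2
    ⟨(hlt k hk).trans (Nat.lt_succ_self _), by simpa using h k⟩
  rw [length_initSeg]
  exact Nat.lt_succ_of_le (Nat.left_le_pair _ _)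

theorem ok_of_mem_paths {r : Baire} {z : ℕ → Bool} (hz : z ∈ paths (projTree n r)) {a : ℕ}
    (ha : z a = true) (s : ℕ) : (z s = true → CauchyOK n a s) ∧ AvoidsOK n a (r (4 * s + 1)) ∧
      NearestOK n a (r (2 * a.unpair.1)) (r (4 * s.unpair.1 + 3)) s.unpair.2 := by
  have h : ProjWord n r (initSeg z (max a s + 1)) := hz _
  have hlt : a < max a s + 1 := Nat.lt_succ_of_le (le_max_left a s)
  have hlt' : s < max a s + 1 := Nat.lt_succ_of_le (le_max_right a s)
  have := h.2 a (by simp) (by rw [getElem?_initSeg hlt, ha]) s (by simp)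
  rwa [getElem?_initSeg hlt', Option.some_inj] at this

/-- A path may set several bits `⟨i, k⟩` for the same `i`. This does no harm: consistency is imposed
on all pairs of set bits, so every selection `q` is a Cauchy name, and every set bit passes the
tests against the balls. -/
theorem exists_projPoint_of_mem_paths (hp : (cauchyRep n).IsName p x) (hneg : NegName n neg A)
    (hpos : PosName n pos A) (hne : A.Nonempty) {z : ℕ → Bool}
    (hz : z ∈ paths (projTree n (join p (join neg pos)))) {q : Baire}
    (hq : ∀ i, z (Nat.pair i (q i)) = true) :
    ∃ y ∈ projPoints x A, (cauchyRep n).IsName q y := by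
  have hok := fun i s => ok_of_mem_paths hz (hq i) s
  simp only [join_join_neg, join_join_pos, join_join_two_mul, Nat.unpair_pair] at hok
  have hcauchy : ∀ i j, i ≤ j →
      dist (ratPoint n (q i)) (ratPoint n (q j)) ≤ (2 : ℝ)⁻¹ ^ i := fun i j hij => by
    have := (hok i (Nat.pair j (q j))).1 (hq j)
    simp only [CauchyOK, Nat.unpair_pair] at this
    exact this hij
  have hseq : CauchySeq fun i => ratPoint n (q i) := by
    refine cauchySeq_of_le_tendsto_0 (fun N => 2 * (2 : ℝ)⁻¹ ^ N) (fun i j N hi hj => ?_) ?_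
    · have h1 := hcauchy N i hi
      have h2 := hcauchy N j hj
      have h3 := dist_triangle_left (ratPoint n (q i)) (ratPoint n (q j)) (ratPoint n (q N))
      linarith
    · simpa using (tendsto_pow_atTop_nhds_zero_of_lt_one (r := (2 : ℝ)⁻¹) (by norm_num)
        (by norm_num)).const_mul 2
  obtain ⟨y, hy⟩ := cauchySeq_tendsto_of_complete hseq
  have hname : (cauchyRep n).IsName q y := ⟨hcauchy, hy⟩
  have hyA : y ∈ A := by
    by_contra hyA
    rw [hneg, Set.notMem_compl_iff] at hyA
    simp only [Set.mem_iUnion, exists_prop] at hyA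
    obtain ⟨_, ⟨s, rfl⟩, hs⟩ := hyA
    simp only [basicBall, Metric.mem_ball] at hs
    obtain ⟨i, hi⟩ := exists_inv_pow_lt (half_pos (sub_pos.2 hs))
    have h1 := dist_cauchyName_le hname i
    have h2 := dist_triangle (ratPoint n (q i)) y (ratPoint n (neg s).unpair.1)
    refine (hok i s).2.1 ?_
    simp only [Nat.unpair_pair]
    linarith
  refine ⟨y, ⟨hyA, le_antisymm ?_ (Metric.infDist_le_dist_of_mem hyA)⟩, hname⟩
  by_contra! hlt
  obtain ⟨a, haA, ha⟩ := (Metric.infDist_lt_iff hne).1 hlt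
  obtain ⟨δ, hδ⟩ : ∃ δ, δ = dist x y - dist x a := ⟨_, rfl⟩
  have hδ0 : 0 < δ := by linarith
  -- The approximation of `a`, the radius of the ball and the slack of `τ` each cost `δ / 8`. With
  -- `2⁻¹ ^ i < δ / 16`, the left side of the test exceeds `dist x a` by less than `10 * δ / 16`,
  -- the right side by more than `14 * δ / 16`.
  obtain ⟨c, hc⟩ := (ratPoint_dense n).exists_dist_lt a (show 0 < δ / 8 by linarith)
  obtain ⟨ρ, hρ, hρ'⟩ := exists_rat_btwn (show dist a (ratPoint n c) < δ / 8 from hc)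
  obtain ⟨d, hd⟩ := nonnegRatNum_surj (q := ρ) (by exact_mod_cast (dist_nonneg.trans hρ.le))
  obtain ⟨u, hu⟩ := (hpos (Nat.pair c d)).2 ⟨a, by simpa [basicBall, hd] using hρ, haA⟩
  obtain ⟨i, hi⟩ := exists_inv_pow_lt (show 0 < δ / 16 by linarith)
  obtain ⟨τ, hτ, hτ'⟩ := exists_rat_btwn
    (show dist (ratPoint n (p i)) (ratPoint n c) < dist (ratPoint n (p i)) (ratPoint n c) + δ / 8
      by linarith)
  obtain ⟨t, ht⟩ := nonnegRatNum_surj (q := τ) (by exact_mod_cast (dist_nonneg.trans hτ.le))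
  have h1 := (hok i (Nat.pair u t)).2.2
  simp only [NearestOK, Nat.unpair_pair, hu, hd, ht] at h1
  refine h1 ⟨hτ, ?_⟩
  have h2 := dist_cauchyName_le hp i
  have h3 := dist_cauchyName_le hname i
  have h4 := dist_triangle4 (ratPoint n (p i)) x a (ratPoint n c)
  have h5 := dist_triangle4 x (ratPoint n (p i)) (ratPoint n (q i)) y
  rw [dist_comm x (ratPoint n (p i))] at h5
  linarith

end

theorem proj_le_WKL (n : ℕ) : StrongWeihrauchLE (Proj n) WKL := by
  classical
  have hpre : Primrec₂ fun (m : ℕ) (l : List ℕ) =>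
      if ProjWord n (fun i => l.getD i 0) (word m) then 1 else 0 :=
    Primrec.ite (primrecPred_projWord n .snd (primrec_word.comp .fst)) (.const 1) (.const 0)
  have hlen : Primrec fun m : ℕ => 4 * (word m).length + 4 :=
    primrec_mul_add 4 4 (Primrec.list_length.comp primrec_word)
  have htest : PrimrecPred fun a : ℕ × ℕ × List ℕ =>
      a.2.2[Nat.pair a.1 a.2.1.unpair.1]? = some 1 :=
    primrecPred_getElem? (Primrec.snd.comp .snd)
      (Primrec₂.natPair.comp .fst (primrec_unpair_fst (Primrec.fst.comp .snd))) (.const 1)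
  refine strongWeihrauchLE_of_initSeg
    (test := fun i s l => l[Nat.pair i s.unpair.1]? = some 1) hpre hlen htest ?_
  rintro r ⟨x, A, hA, hne⟩ ⟨p, _, rfl, hp, neg, pos, rfl, hneg, hpos⟩ -
  refine ⟨projTree n (join p (join neg pos)), infinite_projTree hp hneg hpos hA hne,
    fun m => ?_, ?_⟩
  · have hiff : ProjWord n (fun i => (initSeg (join p (join neg pos))
        (4 * (word m).length + 4)).getD i 0) (word m) ↔
        ProjWord n (join p (join neg pos)) (word m) :=
      ⟨ProjWord.congr fun i hi => getD_initSeg hi,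
        ProjWord.congr fun i hi => (getD_initSeg hi).symm⟩
    beta_reduce
    by_cases h : ProjWord n (join p (join neg pos)) (word m)
    · rw [if_pos (hiff.2 h)]
      exact ⟨Or.inr rfl, fun _ => h, fun _ => rfl⟩
    · rw [if_neg (mt hiff.1 h)]
      exact ⟨Or.inl rfl, fun h0 => absurd h0 (by norm_num), fun h' => absurd h' h⟩
  · intro b z hz hb
    have hb' : ∀ a, b a = 1 ↔ z a = true := fun a => by
      have : b a = (z a).toNat := hb a
      rw [this]
      cases z a <;> simp
    refine ⟨fun i => ?_, fun q hq => ?_⟩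
    · obtain ⟨k, hk⟩ := exists_bit_of_mem_paths hz i
      -- The first component is the output; the second only makes the stage exceed the index of the
      -- bit to be read.
      refine ⟨Nat.pair k (Nat.pair i k + 1), getElem?_initSeg_eq_some.2 ⟨?_, ?_⟩⟩
      · rw [Nat.unpair_pair]
        exact Nat.right_le_pair _ _
      · rw [Nat.unpair_pair]
        exact (hb' _).2 hk
    · refine exists_projPoint_of_mem_paths hp hneg hpos hne hz fun i => ?_
      obtain ⟨s, hs, hsi⟩ := hq i
      rw [← hsi]
      exact (hb' _).1 (getElem?_initSeg_eq_some.1 hs).2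

/-! ### Points on the unit circle coded by binary words -/

/-- The number with the given octal digits. -/
def wordNum (w : List Bool) : ℕ := w.foldl (fun N b => 8 * N + b.toNat) 0

theorem wordNum_concat (w : List Bool) (b : Bool) :
    wordNum (w ++ [b]) = 8 * wordNum w + b.toNat := by
  simp [wordNum]

theorem wordNum_append (u v : List Bool) :
    wordNum (u ++ v) = 8 ^ v.length * wordNum u + wordNum v := by
  induction v using List.reverseRecOn with
  | nil => simp [wordNum]
  | append_singleton v b ih =>
    rw [← List.append_assoc, wordNum_concat, wordNum_concat, ih, List.length_append,
      List.length_singleton]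
    ring

theorem seven_mul_wordNum_le (w : List Bool) : 7 * wordNum w + 1 ≤ 8 ^ w.length := by
  induction w using List.reverseRecOn with
  | nil => simp [wordNum]
  | append_singleton w b ih =>
    rw [wordNum_concat, List.length_append, List.length_singleton, pow_succ]
    have := Bool.toNat_le b
    omega

theorem wordNum_injective {u v : List Bool} (hlen : u.length = v.length)
    (h : wordNum u = wordNum v) : u = v := by
  induction u using List.reverseRecOn generalizing v with
  | nil => exact (List.length_eq_zero_iff.1 hlen.symm).symm
  | append_singleton u b ih =>
    rcases List.eq_nil_or_concat v with rfl | ⟨v, c, rfl⟩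
    · simp at hlen
    · rw [List.concat_eq_append] at h hlen ⊢
      rw [wordNum_concat, wordNum_concat] at h
      have hb := Bool.toNat_le b
      have hc := Bool.toNat_le c
      have hbc : b.toNat = c.toNat := by omega
      have : b = c := by
        revert hbc
        cases b <;> cases c <;> simp
      rw [ih (by simpa using hlen) (by omega), this]

/-- The number in the unit interval with the given octal digits. -/
def wordParam (w : List Bool) : ℚ := wordNum w / 8 ^ w.length

theorem wordParam_nonneg (w : List Bool) : 0 ≤ wordParam w := by
  unfold wordParam
  positivity

theorem wordParam_le (w : List Bool) : wordParam w ≤ 1 / 7 := by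
  have h : (7 * wordNum w + 1 : ℚ) ≤ 8 ^ w.length := by exact_mod_cast seven_mul_wordNum_le w
  rw [wordParam, div_le_iff₀ (by positivity)]
  linarith

theorem wordParam_append (u v : List Bool) :
    wordParam (u ++ v) = wordParam u + 8⁻¹ ^ u.length * wordParam v := by
  have h1 : (8 : ℚ) ^ u.length ≠ 0 := by positivity
  have h2 : (8 : ℚ) ^ v.length ≠ 0 := by positivity
  simp only [wordParam, wordNum_append, List.length_append, pow_add, inv_pow]
  push_cast
  field_simp

theorem abs_wordParam_sub_append_le (u v : List Bool) :
    |wordParam u - wordParam (u ++ v)| ≤ 8⁻¹ ^ u.length / 7 := by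
  have h : (0 : ℚ) ≤ 8⁻¹ ^ u.length := by positivity
  rw [wordParam_append, sub_add_cancel_left, abs_neg, abs_of_nonneg
    (mul_nonneg h (wordParam_nonneg v)), div_eq_mul_one_div]
  gcongr
  exact wordParam_le v

/-- Over the common denominator `8 ^ u.length` the numerators are distinct integers. Extending a
word moves its parameter by at most a seventh of this gap. -/
theorem le_abs_wordParam_sub {u v : List Bool} (hlen : u.length = v.length) (h : u ≠ v) :
    8⁻¹ ^ u.length ≤ |wordParam u - wordParam v| := by
  have hne : (wordNum u : ℤ) - wordNum v ≠ 0 := by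
    intro h0
    exact h (wordNum_injective hlen (by omega))
  have h1 : (1 : ℚ) ≤ |(wordNum u : ℚ) - wordNum v| := by
    exact_mod_cast Int.one_le_abs hne
  rw [wordParam, wordParam, ← hlen, ← sub_div, abs_div,
    abs_of_pos (by positivity : (0 : ℚ) < 8 ^ u.length), inv_pow, ← one_div]
  gcongr

/-- The coordinates of the rational parametrization of the unit circle. -/
def circle (t : ℚ) : ℕ → ℚ
  | 0 => 2 * t / (1 + t ^ 2)
  | 1 => (1 - t ^ 2) / (1 + t ^ 2)
  | _ => 0

theorem circle_sq_add_sq (t : ℚ) : circle t 0 ^ 2 + circle t 1 ^ 2 = 1 := by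
  have : 1 + t ^ 2 ≠ 0 := by positivity
  simp only [circle]
  field_simp
  ring

theorem sqDist_eq_of_planar {n : ℕ} (hn : 2 ≤ n) {v w : ℕ → ℚ} (h : ∀ i, v (i + 2) = w (i + 2)) :
    sqDist n v w = (v 0 - w 0) ^ 2 + (v 1 - w 1) ^ 2 := by
  obtain ⟨m, rfl⟩ := Nat.exists_eq_add_of_le' hn
  rw [sqDist, Finset.sum_range_succ', Finset.sum_range_succ']
  simp only [h, sub_self, ne_eq, two_ne_zero, not_false_eq_true, zero_pow, Finset.sum_const_zero,
    zero_add]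
  exact add_comm _ _

/-- This chord formula makes the parametrization bi-Lipschitz for parameters in `[-1, 1]`, with
constants 1 and 2. -/
theorem sqDist_circle {n : ℕ} (hn : 2 ≤ n) (s t : ℚ) :
    sqDist n (circle s) (circle t) = 4 * (s - t) ^ 2 / ((1 + s ^ 2) * (1 + t ^ 2)) := by
  rw [sqDist_eq_of_planar hn (v := circle s) (w := circle t) fun _ => rfl]
  have h1 : 1 + s ^ 2 ≠ 0 := by positivity
  have h2 : 1 + t ^ 2 ≠ 0 := by positivity
  simp only [circle]
  field_simp
  ring

theorem dist_circle_le {n : ℕ} (hn : 2 ≤ n) (s t : ℚ) :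
    dist (toEuc n (circle s)) (toEuc n (circle t)) ≤ ((2 * |s - t| : ℚ) : ℝ) := by
  refine dist_toEuc_le_iff.2 ⟨by positivity, ?_⟩
  rw [sqDist_circle hn, mul_pow, sq_abs]
  refine (div_le_self (by positivity) ?_).trans (by norm_num)
  nlinarith [sq_nonneg s, sq_nonneg t, mul_nonneg (sq_nonneg s) (sq_nonneg t)]

theorem le_dist_circle {n : ℕ} (hn : 2 ≤ n) {s t : ℚ} (hs : s ^ 2 ≤ 1) (ht : t ^ 2 ≤ 1) :
    ((|s - t| : ℚ) : ℝ) ≤ dist (toEuc n (circle s)) (toEuc n (circle t)) := by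
  by_contra! h
  have h2 := (dist_toEuc_lt_iff.1 h).2
  rw [sqDist_circle hn, sq_abs, div_lt_iff₀ (by positivity)] at h2
  have h3 : (1 + s ^ 2) * (1 + t ^ 2) ≤ 4 := by nlinarith [sq_nonneg s, sq_nonneg t]
  nlinarith [mul_le_mul_of_nonneg_left h3 (sq_nonneg (s - t))]

/-- The point of the unit circle coded by a word. -/
def circlePoint (n : ℕ) (w : List Bool) : Euc n := toEuc n (circle (wordParam w))

/-- The factor by which the point coded by a word is moved off the unit circle. -/
def levelFactor (w : List Bool) : ℚ := 1 + 8⁻¹ ^ w.length / 16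

/-- The point coded by a word, outside of the unit disc and nearer to it for longer words. -/
def levelPoint (n : ℕ) (w : List Bool) : Euc n :=
  toEuc n fun i => levelFactor w * circle (wordParam w) i

theorem ratPoint_zero (n : ℕ) : ratPoint n 0 = toEuc n fun _ => 0 := by
  have h : ∀ i, entry i 0 = 0 := fun i => Nat.le_zero.1 (entry_le i 0)
  simp [ratPoint_eq_toEuc, h, ratNum]

/-! ### Metric estimates for the coded points -/

section

variable {n : ℕ}

theorem dist_toEuc_smul_circle (hn : 2 ≤ n) {a b : ℚ} (hab : b ≤ a) (t : ℚ) :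
    dist (toEuc n fun i => a * circle t i) (toEuc n fun i => b * circle t i) =
      ((a - b : ℚ) : ℝ) := by
  have h : dist (toEuc n fun i => a * circle t i) (toEuc n fun i => b * circle t i) ^ 2 =
      ((a - b : ℚ) : ℝ) ^ 2 := by
    rw [dist_toEuc_sq, sqDist_eq_of_planar hn fun _ => by simp [circle], ← Rat.cast_pow]
    congr 1
    linear_combination (a - b) ^ 2 * circle_sq_add_sq t
  exact (pow_left_inj₀ dist_nonneg (by exact_mod_cast sub_nonneg.2 hab) two_ne_zero).1 h

theorem dist_levelPoint_circlePoint (hn : 2 ≤ n) (w : List Bool) :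
    dist (levelPoint n w) (circlePoint n w) = (8 : ℝ)⁻¹ ^ w.length / 16 := by
  have hle : (1 : ℚ) ≤ levelFactor w := by
    unfold levelFactor
    have : (0 : ℚ) ≤ 8⁻¹ ^ w.length / 16 := by positivity
    linarith
  have h := dist_toEuc_smul_circle hn hle (wordParam w)
  simp only [one_mul] at h
  rw [levelPoint, circlePoint, h, levelFactor]
  push_cast
  ring

theorem dist_zero_levelPoint (hn : 2 ≤ n) (w : List Bool) :
    dist (ratPoint n 0) (levelPoint n w) = 1 + (8 : ℝ)⁻¹ ^ w.length / 16 := by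
  have hle : (0 : ℚ) ≤ levelFactor w := by
    unfold levelFactor
    positivity
  have h := dist_toEuc_smul_circle hn hle (wordParam w)
  simp only [zero_mul] at h
  rw [dist_comm, ratPoint_zero, levelPoint, h, levelFactor]
  push_cast
  ring

theorem dist_circlePoint_append_le (hn : 2 ≤ n) (u v : List Bool) :
    dist (circlePoint n u) (circlePoint n (u ++ v)) ≤ (8 : ℝ)⁻¹ ^ u.length * (2 / 7) := by
  have h1 := dist_circle_le hn (wordParam u) (wordParam (u ++ v))
  have h2 : ((|wordParam u - wordParam (u ++ v)| : ℚ) : ℝ) ≤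
      ((8⁻¹ ^ u.length / 7 : ℚ) : ℝ) := by
    exact_mod_cast abs_wordParam_sub_append_le u v
  rw [circlePoint, circlePoint]
  push_cast at h1 h2
  linarith

theorem le_dist_circlePoint (hn : 2 ≤ n) {u v : List Bool} (hlen : u.length = v.length)
    (h : u ≠ v) : (8 : ℝ)⁻¹ ^ u.length ≤ dist (circlePoint n u) (circlePoint n v) := by
  have hsq : ∀ w, wordParam w ^ 2 ≤ 1 := fun w => by
    nlinarith [wordParam_nonneg w, wordParam_le w]
  have h1 := le_dist_circle hn (hsq u) (hsq v)
  have h2 : ((8⁻¹ ^ u.length : ℚ) : ℝ) ≤ ((|wordParam u - wordParam v| : ℚ) : ℝ) := by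
    exact_mod_cast le_abs_wordParam_sub hlen h
  push_cast at h1 h2
  exact h2.trans h1

theorem inv_pow_length_append_le (u v : List Bool) :
    (8 : ℝ)⁻¹ ^ (u ++ v).length ≤ (8 : ℝ)⁻¹ ^ u.length :=
  pow_le_pow_of_le_one (by norm_num) (by norm_num) (by simp)

/-- Here `2 / 7` comes from the digits of `v` and at most `1 / 16` from the radial shift. The sum is
below `3 / 8`, hence below half of the gap between words of equal length. -/
theorem dist_levelPoint_append_circlePoint_le (hn : 2 ≤ n) (u v : List Bool) :
    dist (levelPoint n (u ++ v)) (circlePoint n u) ≤ (8 : ℝ)⁻¹ ^ u.length * (3 / 8) := by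
  have h1 := dist_levelPoint_circlePoint hn (u ++ v)
  have h2 := dist_circlePoint_append_le hn u v
  have h3 := inv_pow_length_append_le u v
  have h4 := dist_triangle_right (levelPoint n (u ++ v)) (circlePoint n u)
    (circlePoint n (u ++ v))
  have h5 : (0 : ℝ) ≤ 8⁻¹ ^ u.length := by positivity
  linarith

theorem dist_levelPoint_append_le (hn : 2 ≤ n) (u v : List Bool) :
    dist (levelPoint n (u ++ v)) (levelPoint n u) ≤ (8 : ℝ)⁻¹ ^ u.length := by
  have h1 := dist_levelPoint_circlePoint hn u
  have h2 := dist_levelPoint_append_circlePoint_le hn u v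
  have h3 := dist_triangle_right (levelPoint n (u ++ v)) (levelPoint n u) (circlePoint n u)
  have h4 : (0 : ℝ) ≤ 8⁻¹ ^ u.length := by positivity
  linarith

end

/-! ### The closed set coded by a tree -/

/-- The closure of the points coded by the words of a tree. -/
def treeSet (n : ℕ) (T : BinTree) : Set (Euc n) := closure (levelPoint n '' T.1)

theorem exists_mem_length {T : BinTree} (hT : T.1.Infinite) (m : ℕ) : ∃ w ∈ T.1, w.length = m := by
  by_contra! h
  refine hT ((List.finite_length_lt Bool m).subset fun w hw => ?_)
  by_contra! hlen
  refine h (w.take m) (T.2 w hw _ (List.take_prefix m w)) ?_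
  rw [List.length_take]
  exact min_eq_left (not_lt.1 hlen)

/-- The word codes a point of the circle so near that no other word of the same length does. -/
def NearWord (n : ℕ) (y : Euc n) (w : List Bool) : Prop :=
  dist y (circlePoint n w) < (8 : ℝ)⁻¹ ^ w.length / 2

section

variable {n : ℕ}

theorem NearWord.unique (hn : 2 ≤ n) {y : Euc n} {u v : List Bool}
    (hu : NearWord n y u) (hv : NearWord n y v) (hlen : u.length = v.length) : u = v := by
  by_contra h
  have h1 := le_dist_circlePoint hn hlen h
  have h2 := dist_triangle_left (circlePoint n u) (circlePoint n v) y
  unfold NearWord at hu hv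
  rw [← hlen] at hv
  linarith

theorem NearWord.of_concat (hn : 2 ≤ n) {y : Euc n} {u : List Bool} {b : Bool}
    (h : NearWord n y (u ++ [b])) : NearWord n y u := by
  have h1 := dist_circlePoint_append_le hn u [b]
  have h2 := dist_triangle_right y (circlePoint n u) (circlePoint n (u ++ [b]))
  have h3 : (0 : ℝ) < 8⁻¹ ^ u.length := by positivity
  unfold NearWord at *
  rw [List.length_append, List.length_singleton, pow_succ] at h
  linarith

/-- Words shorter than `m` contribute a finite, hence closed, set, and none of its points is nearest
since a word of length `m` gives a nearer one. The points of the remaining words lie in finitely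
many closed balls around the circle points of their prefixes of length `m`, so the closure does too.
-/
theorem exists_nearWord (hn : 2 ≤ n) {T : BinTree} (hT : T.1.Infinite) {y : Euc n}
    (hy : y ∈ projPoints (ratPoint n 0) (treeSet n T)) (m : ℕ) :
    ∃ w ∈ T.1, w.length = m ∧ NearWord n y w := by
  have hsplit : T.1 = {w ∈ T.1 | w.length < m} ∪ {w ∈ T.1 | m ≤ w.length} := by
    ext w
    have := lt_or_ge w.length m
    simp only [Set.mem_union, Set.mem_ofPred_eq]
    tauto
  have hmem := hy.1
  rw [treeSet, hsplit, Set.image_union, closure_union] at hmem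
  rcases hmem with hmem | hmem
  · have hfin : {w ∈ T.1 | w.length < m}.Finite :=
      (List.finite_length_lt Bool m).subset fun w hw => hw.2
    rw [(hfin.image _).isClosed.closure_eq] at hmem
    obtain ⟨w, ⟨-, hw⟩, rfl⟩ := hmem
    obtain ⟨v, hv, hvm⟩ := exists_mem_length hT m
    have h1 : Metric.infDist (ratPoint n 0) (treeSet n T) ≤
        dist (ratPoint n 0) (levelPoint n v) :=
      Metric.infDist_le_dist_of_mem (subset_closure ⟨v, hv, rfl⟩)
    rw [← hy.2, dist_zero_levelPoint hn, dist_zero_levelPoint hn, hvm] at h1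
    have h2 : (8 : ℝ)⁻¹ ^ m < (8 : ℝ)⁻¹ ^ w.length :=
      pow_lt_pow_right_of_lt_one₀ (by norm_num) (by norm_num) hw
    linarith
  · have hfin : {w ∈ T.1 | w.length = m}.Finite :=
      (List.finite_length_eq Bool m).subset fun w hw => hw.2
    have hclosed : IsClosed (⋃ w ∈ {w ∈ T.1 | w.length = m},
        Metric.closedBall (circlePoint n w) ((8 : ℝ)⁻¹ ^ m * (3 / 8))) :=
      hfin.isClosed_biUnion fun _ _ => Metric.isClosed_closedBall
    have hsub : levelPoint n '' {w ∈ T.1 | m ≤ w.length} ⊆ ⋃ w ∈ {w ∈ T.1 | w.length = m},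
        Metric.closedBall (circlePoint n w) ((8 : ℝ)⁻¹ ^ m * (3 / 8)) := by
      rintro _ ⟨w, ⟨hw, hlen⟩, rfl⟩
      have hlen' : (w.take m).length = m := by rw [List.length_take, min_eq_left hlen]
      refine Set.mem_biUnion (x := w.take m) ⟨T.2 w hw _ (List.take_prefix m w), hlen'⟩ ?_
      have h := dist_levelPoint_append_circlePoint_le hn (w.take m) (w.drop m)
      rwa [List.take_append_drop, hlen'] at h
    have := closure_minimal hsub hclosed hmem
    simp only [Set.mem_iUnion, exists_prop] at this
    obtain ⟨w, ⟨hw, hlen⟩, hdist⟩ := this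
    refine ⟨w, hw, hlen, ?_⟩
    have h0 : (0 : ℝ) < 8⁻¹ ^ m := by positivity
    rw [Metric.mem_closedBall] at hdist
    rw [NearWord, hlen]
    linarith

theorem exists_path_of_projPoint (hn : 2 ≤ n) {T : BinTree} (hT : T.1.Infinite) {y : Euc n}
    (hy : y ∈ projPoints (ratPoint n 0) (treeSet n T)) :
    ∃ z ∈ paths T, ∀ m, NearWord n y (initSeg z m) := by
  choose w hwT hlen hnear using exists_nearWord hn hT hy
  -- The near words are chosen independently for each length; uniqueness forces each to extend the
  -- previous one. The default `false` is never used, as `w (m + 1)` has length `m + 1`.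
  have hstep : ∀ m, w (m + 1) = w m ++ [(w (m + 1)).getD m false] := fun m => by
    rcases List.eq_nil_or_concat (w (m + 1)) with h | ⟨u, b, h⟩
    · have := hlen (m + 1)
      rw [h] at this
      simp at this
    · rw [List.concat_eq_append] at h
      have hu : u.length = m := by
        have := hlen (m + 1)
        rw [h] at this
        simpa using this
      have hnear' := hnear (m + 1)
      rw [h] at hnear'
      have hb : (u ++ [b]).getD m false = b := by
        rw [← hu]
        simp
      have huw : u = w m :=
        NearWord.unique hn (NearWord.of_concat hn hnear') (hnear m) (hu.trans (hlen m).symm)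
      rw [h, ← huw, hb]
  have hw : ∀ m, initSeg (fun m => (w (m + 1)).getD m false) m = w m := fun m => by
    induction m with
    | zero => exact (List.length_eq_zero_iff.1 (hlen 0)).symm
    | succ m ih => rw [initSeg_succ, ih, ← hstep]
  refine ⟨fun m => (w (m + 1)).getD m false, fun m => ?_, fun m => ?_⟩
  · change initSeg _ m ∈ T.1
    exact hw m ▸ hwT m
  · rw [hw]
    exact hnear m

end

/-! ### Finding paths by projecting -/

section

variable {α : Type} [Primcodable α]

theorem primrec_wordNum : Primrec wordNum := by
  have hstep : Primrec₂ fun (_ : List Bool) (z : ℕ × Bool) => 8 * z.1 + z.2.toNat :=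
    Primrec.nat_add.comp (Primrec.nat_mul.comp (Primrec.const 8) (Primrec.fst.comp .snd))
      ((Primrec.dom_bool Bool.toNat).comp (Primrec.snd.comp .snd))
  exact Primrec.list_foldl Primrec.id (Primrec.const 0) hstep

theorem ratPrimrec_circle {w : α → List Bool} (hw : Primrec w) (i : ℕ) :
    RatPrimrec fun x => circle (wordParam (w x)) i := by
  have hN : Primrec fun x => wordNum (w x) := primrec_wordNum.comp hw
  have hE : Primrec fun x => 8 ^ (w x).length :=
    primrec_natPow.comp (Primrec.const 8) (Primrec.list_length.comp hw)
  have hN2 := Primrec.nat_mul.comp hN hN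
  have hE2 := Primrec.nat_mul.comp hE hE
  have hD : Primrec fun x => 8 ^ (w x).length * 8 ^ (w x).length + wordNum (w x) * wordNum (w x) :=
    Primrec.nat_add.comp hE2 hN2
  have hpos : ∀ x, 0 < 8 ^ (w x).length * 8 ^ (w x).length + wordNum (w x) * wordNum (w x) :=
    fun x => by positivity
  match i with
  | 0 =>
    refine (RatPrimrec.div_nat (Primrec.nat_mul.comp (Primrec.const 2) (Primrec.nat_mul.comp hN hE))
      hD hpos).of_eq fun x => ?_
    have : (8 : ℚ) ^ (w x).length ≠ 0 := by positivity
    simp only [circle, wordParam]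
    push_cast
    field_simp
  | 1 =>
    refine ((RatPrimrec.div_nat hE2 hD hpos).sub (RatPrimrec.div_nat hN2 hD hpos)).of_eq
      fun x => ?_
    have : (8 : ℚ) ^ (w x).length ≠ 0 := by positivity
    simp only [circle, wordParam]
    push_cast
    field_simp
  | i + 2 => exact (RatPrimrec.natConst 0).of_eq fun x => Nat.cast_zero

theorem ratPrimrec_levelPoint {w : α → List Bool} (hw : Primrec w) (i : ℕ) :
    RatPrimrec fun x => levelFactor (w x) * circle (wordParam (w x)) i := by
  refine RatPrimrec.mul (((RatPrimrec.natConst 1).add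
    ((RatPrimrec.inv_pow (b := 8) (Primrec.list_length.comp hw) (by norm_num)).mul
      (RatPrimrec.div_nat (Primrec.const 1) (Primrec.const 16) fun _ => by norm_num))).of_eq
        fun x => ?_) (ratPrimrec_circle hw i)
  rw [levelFactor]
  push_cast
  ring

end

/-- The words of length at most `m`. -/
def wordsUpTo : ℕ → List (List Bool)
  | 0 => [[]]
  | m + 1 => [] :: (wordsUpTo m).flatMap fun w => [false :: w, true :: w]

theorem mem_wordsUpTo {m : ℕ} {w : List Bool} : w ∈ wordsUpTo m ↔ w.length ≤ m := by
  induction m generalizing w with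
  | zero => simp [wordsUpTo]
  | succ m ih =>
    cases w with
    | nil => simp [wordsUpTo]
    | cons b w => cases b <;> simp [wordsUpTo, ih]

theorem primrec_wordsUpTo : Primrec wordsUpTo := by
  have hcons : ∀ b, Primrec₂ fun (_ : ℕ × List (List Bool)) (w : List Bool) => b :: w := fun b =>
    Primrec.list_cons.comp (Primrec.const b) .snd
  have hstep : Primrec₂ fun (_ : ℕ) (L : List (List Bool)) =>
      [] :: L.flatMap fun w => [false :: w, true :: w] :=
    Primrec.list_cons.comp (Primrec.const []) (Primrec.list_flatMap .snd
      (Primrec.list_cons.comp (hcons false) (Primrec.list_cons.comp (hcons true) (.const []))))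
  refine (Primrec.nat_rec₁ [[]] hstep).of_eq fun m => ?_
  induction m with
  | zero => rfl
  | succ m ih => simp only [wordsUpTo, ← ih]

/-- The part `l` of the characteristic function of a tree shows that the basic ball `k` is disjoint
from the closed set: it stays away from the points coded by words of length at most `m`. -/
def SeenDisjoint (n k m : ℕ) (l : List ℕ) : Prop :=
  ∀ w ∈ wordsUpTo m, Encodable.encode w < l.length ∧ (l.getD (Encodable.encode w) 0 = 1 →
    ¬ dist (ratPoint n k.unpair.1) (levelPoint n w) <
      ((nonnegRatNum k.unpair.2 : ℚ) : ℝ) + (8 : ℝ)⁻¹ ^ m)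

/-- The part `l` of the characteristic function of a tree shows that the basic ball `k` contains
the point coded by the word with the number `j`. -/
def SeenMeeting (n k j : ℕ) (l : List ℕ) : Prop :=
  l.getD j 0 = 1 ∧ dist (ratPoint n k.unpair.1) (levelPoint n (word j)) <
    ((nonnegRatNum k.unpair.2 : ℚ) : ℝ)

section

variable {α : Type} [Primcodable α]

theorem primrecPred_dist_levelPoint_lt (n : ℕ) {u : α → ℕ} {w : α → List Bool} {r : α → ℚ}
    {ρ : α → ℝ} (hu : Primrec u) (hw : Primrec w) (hr : RatPrimrec r) (h : ∀ x, (r x : ℝ) = ρ x) :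
    PrimrecPred fun x => dist (ratPoint n (u x)) (levelPoint n (w x)) < ρ x :=
  (primrecPred_dist_lt (n := n) (ratPrimrec_coord hu) (ratPrimrec_levelPoint hw) hr).of_eq
    fun x => by rw [ratPoint_eq_toEuc, levelPoint, h]

theorem primrecPred_dist_circlePoint_lt (n : ℕ) {u : α → ℕ} {w : α → List Bool} {r : α → ℚ}
    {ρ : α → ℝ} (hu : Primrec u) (hw : Primrec w) (hr : RatPrimrec r) (h : ∀ x, (r x : ℝ) = ρ x) :
    PrimrecPred fun x => dist (ratPoint n (u x)) (circlePoint n (w x)) < ρ x :=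
  (primrecPred_dist_lt (n := n) (ratPrimrec_coord hu) (ratPrimrec_circle hw) hr).of_eq
    fun x => by rw [ratPoint_eq_toEuc, circlePoint, h]

theorem primrecPred_seenDisjoint (n : ℕ) {k m : α → ℕ} {l : α → List ℕ} (hk : Primrec k)
    (hm : Primrec m) (hl : Primrec l) : PrimrecPred fun x => SeenDisjoint n (k x) (m x) (l x) := by
  have hx : Primrec fun z : List Bool × α => z.2 := .snd
  have hw : Primrec fun z : List Bool × α => z.1 := .fst
  have h1 : PrimrecPred fun z : List Bool × α => Encodable.encode z.1 < (l z.2).length :=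
    Primrec.nat_lt.comp (Primrec.encode.comp hw) (Primrec.list_length.comp (hl.comp hx))
  have h2 : PrimrecPred fun z : List Bool × α => (l z.2).getD (Encodable.encode z.1) 0 = 1 :=
    Primrec.eq.comp (primrec_getD (hl.comp hx) (Primrec.encode.comp hw)) (.const 1)
  have h3 : PrimrecPred fun z : List Bool × α =>
      dist (ratPoint n (k z.2).unpair.1) (levelPoint n z.1) <
        ((nonnegRatNum (k z.2).unpair.2 : ℚ) : ℝ) + (8 : ℝ)⁻¹ ^ m z.2 :=
    primrecPred_dist_levelPoint_lt n (primrec_unpair_fst (hk.comp hx)) hw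
      ((RatPrimrec.nonnegRatNum (primrec_unpair_snd (hk.comp hx))).add
        (RatPrimrec.inv_pow (b := 8) (hm.comp hx) (by norm_num))) fun z => by push_cast; rfl
  have h4 : PrimrecRel fun (w : List Bool) (x : α) =>
      Encodable.encode w < (l x).length ∧ ((l x).getD (Encodable.encode w) 0 = 1 →
        ¬ dist (ratPoint n (k x).unpair.1) (levelPoint n w) <
          ((nonnegRatNum (k x).unpair.2 : ℚ) : ℝ) + (8 : ℝ)⁻¹ ^ m x) :=
    h1.and (primrecPred_imp h2 h3.not)
  exact h4.forall_mem_list.comp (primrec_wordsUpTo.comp hm) Primrec.id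

theorem primrecPred_seenMeeting (n : ℕ) {k j : α → ℕ} {l : α → List ℕ} (hk : Primrec k)
    (hj : Primrec j) (hl : Primrec l) : PrimrecPred fun x => SeenMeeting n (k x) (j x) (l x) :=
  PrimrecPred.and (Primrec.eq.comp (primrec_getD hl hj) (.const 1))
    (primrecPred_dist_levelPoint_lt n (primrec_unpair_fst hk) (primrec_word.comp hj)
      (RatPrimrec.nonnegRatNum (primrec_unpair_snd hk)) fun _ => rfl)

end

open Classical in
/-- An entry of a negative name of the closed set coded by a tree. -/
def negEntry (n s : ℕ) (l : List ℕ) : ℕ :=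
  if SeenDisjoint n s.unpair.1.unpair.1 s.unpair.1.unpair.2 l then s.unpair.1.unpair.1 else 0

open Classical in
/-- An entry of a positive name of the closed set coded by a tree. -/
def posEntry (n s : ℕ) (l : List ℕ) : ℕ :=
  if SeenMeeting n s.unpair.1 s.unpair.2 l then s.unpair.1 else Nat.pair 0 (Nat.pair 2 0)

theorem primrec_negEntry (n : ℕ) : Primrec₂ (negEntry n) := by
  classical
  have hs : Primrec fun z : ℕ × List ℕ => z.1.unpair.1 := primrec_unpair_fst .fst
  exact Primrec.ite (primrecPred_seenDisjoint n (primrec_unpair_fst hs) (primrec_unpair_snd hs)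
    .snd) (primrec_unpair_fst hs) (.const 0)

theorem primrec_posEntry (n : ℕ) : Primrec₂ (posEntry n) := by
  classical
  exact Primrec.ite (primrecPred_seenMeeting n (primrec_unpair_fst .fst)
    (primrec_unpair_snd .fst) .snd) (primrec_unpair_fst .fst) (.const _)

/-! ### Correctness of the total information name -/

section

variable {n : ℕ} {t : Baire} {T : BinTree}

theorem tree_encode (ht : treeRep.IsName t T) (w : List Bool) :
    t (Encodable.encode w) = 1 ↔ w ∈ T.1 := by
  rw [(ht _).2, word_encode]

theorem basicBall_inter_treeSet {k : ℕ} : (basicBall n k ∩ treeSet n T).Nonempty ↔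
    ∃ w ∈ T.1, levelPoint n w ∈ basicBall n k := by
  have hopen : IsOpen (basicBall n k) := Metric.isOpen_ball
  rw [treeSet, Set.inter_comm, closure_inter_open_nonempty_iff hopen]
  constructor
  · rintro ⟨_, ⟨w, hw, rfl⟩, hk⟩
    exact ⟨w, hw, hk⟩
  · rintro ⟨w, hw, hk⟩
    exact ⟨_, ⟨w, hw, rfl⟩, hk⟩

/-- The margin `8⁻¹ ^ m` in `SeenDisjoint` covers all words longer than `m`, whose points are within
that distance of the point of their prefix of length `m`. -/
theorem not_mem_basicBall_of_seenDisjoint (hn : 2 ≤ n) (ht : treeRep.IsName t T) {k m s : ℕ}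
    (h : SeenDisjoint n k m (initSeg t s)) {w : List Bool} (hw : w ∈ T.1) :
    levelPoint n w ∉ basicBall n k := by
  have key : ∀ v ∈ T.1, v.length ≤ m → ((nonnegRatNum k.unpair.2 : ℚ) : ℝ) + (8 : ℝ)⁻¹ ^ m ≤
      dist (ratPoint n k.unpair.1) (levelPoint n v) := fun v hv hlen => by
    obtain ⟨h1, h2⟩ := h v (mem_wordsUpTo.2 hlen)
    rw [length_initSeg] at h1
    rw [getD_initSeg h1] at h2
    exact not_lt.1 (h2 ((tree_encode ht v).2 hv))
  have hpos : (0 : ℝ) < 8⁻¹ ^ m := by positivity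
  rw [basicBall, Metric.mem_ball, dist_comm, not_lt]
  by_cases hlen : w.length ≤ m
  · linarith [key w hw hlen]
  · have hlen' : (w.take m).length = m := by
      rw [List.length_take, min_eq_left (not_le.1 hlen).le]
    have h1 := key (w.take m) (T.2 w hw _ (List.take_prefix m w)) hlen'.le
    have h2 := dist_levelPoint_append_le hn (w.take m) (w.drop m)
    rw [List.take_append_drop, hlen'] at h2
    have h3 := dist_triangle (ratPoint n k.unpair.1) (levelPoint n w) (levelPoint n (w.take m))
    linarith

theorem exists_seenDisjoint (ht : treeRep.IsName t T) {y : Euc n} (hy : y ∉ treeSet n T) :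
    ∃ k m, y ∈ basicBall n k ∧ ∃ L, ∀ s, L ≤ s → SeenDisjoint n k m (initSeg t s) := by
  obtain ⟨ε, hε, hball⟩ := Metric.isOpen_iff.1 isClosed_closure.isOpen_compl y hy
  obtain ⟨ρ, hρ0, hρ⟩ := exists_rat_btwn (show 0 < ε / 4 by linarith)
  obtain ⟨c, hc⟩ := (ratPoint_dense n).exists_dist_lt y hρ0
  obtain ⟨d, hd⟩ := nonnegRatNum_surj (q := ρ) (by exact_mod_cast hρ0.le)
  obtain ⟨m, hm⟩ : ∃ m : ℕ, (8 : ℝ)⁻¹ ^ m < ε / 2 :=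
    exists_pow_lt_of_lt_one (by linarith) (by norm_num)
  obtain ⟨L, hL⟩ : ∃ L, ∀ w ∈ wordsUpTo m, Encodable.encode w < L := by
    obtain ⟨L, hL⟩ := (((List.finite_toSet (wordsUpTo m)).image Encodable.encode).bddAbove)
    exact ⟨L + 1, fun w hw => Nat.lt_succ_of_le (hL ⟨w, hw, rfl⟩)⟩
  refine ⟨Nat.pair c d, m, ?_, L, fun s hs w hw => ?_⟩
  · simpa [basicBall, hd] using hc
  · have hlt : Encodable.encode w < s := (hL w hw).trans_le hs
    rw [length_initSeg, getD_initSeg hlt]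
    refine ⟨hlt, fun h => not_lt.2 ?_⟩
    have hw' : levelPoint n w ∈ treeSet n T := subset_closure ⟨w, (tree_encode ht w).1 h, rfl⟩
    have h1 : ε ≤ dist (levelPoint n w) y := by
      by_contra! h1
      exact hball h1 hw'
    have h2 := dist_triangle_left (levelPoint n w) y (ratPoint n c)
    rw [dist_comm] at hc
    simp only [Nat.unpair_pair, hd]
    linarith

theorem negName_treeSet (hn : 2 ≤ n) (ht : treeRep.IsName t T) :
    NegName n (fun s => negEntry n s (initSeg t (s + 1))) (treeSet n T) := by
  rw [NegName, eq_compl_comm]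
  ext y
  simp only [Set.mem_iUnion, exists_prop, Set.mem_range, exists_exists_eq_and, Set.mem_compl_iff]
  constructor
  · rintro ⟨s, hs⟩ hy
    unfold negEntry at hs
    split_ifs at hs with h
    · obtain ⟨w, hw, hwk⟩ := basicBall_inter_treeSet.1 ⟨y, hs, hy⟩
      exact not_mem_basicBall_of_seenDisjoint hn ht h hw hwk
    -- The default code 0 is a ball of radius 0, which is empty.
    · simp [basicBall, nonnegRatNum] at hs
  · intro hy
    obtain ⟨k, m, hk, L, hL⟩ := exists_seenDisjoint ht hy
    -- The component `L` is padding: it makes the initial segment long enough for the test to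
    -- succeed.
    refine ⟨Nat.pair (Nat.pair k m) L, ?_⟩
    have := hL (Nat.pair (Nat.pair k m) L + 1) (Nat.le_succ_of_le (Nat.right_le_pair _ _))
    simpa [negEntry, this] using hk

theorem posName_treeSet (hn : 2 ≤ n) (ht : treeRep.IsName t T) (hT : T.1.Infinite) :
    PosName n (fun s => posEntry n s (initSeg t (s + 1))) (treeSet n T) := by
  intro k
  rw [basicBall_inter_treeSet]
  constructor
  · rintro ⟨s, rfl⟩
    beta_reduce
    unfold posEntry
    split_ifs with h
    · obtain ⟨h1, h2⟩ := h
      rw [getD_initSeg (Nat.lt_succ_of_le (Nat.unpair_right_le s))] at h1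
      rw [dist_comm] at h2
      exact ⟨word s.unpair.2, (ht _).2.1 h1, h2⟩
    -- The default is the ball of radius 2 around the origin, which contains every coded point.
    · obtain ⟨w, hw, -⟩ := exists_mem_length hT 0
      refine ⟨w, hw, ?_⟩
      have h1 : (8 : ℝ)⁻¹ ^ w.length ≤ 1 := pow_le_one₀ (by norm_num) (by norm_num)
      rw [basicBall, Metric.mem_ball, dist_comm, Nat.unpair_pair, dist_zero_levelPoint hn]
      simp only [nonnegRatNum, Nat.unpair_pair]
      push_cast
      linarith
  · rintro ⟨w, hw, hk⟩
    refine ⟨Nat.pair k (Encodable.encode w), ?_⟩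
    have h1 : Encodable.encode w < Nat.pair k (Encodable.encode w) + 1 :=
      Nat.lt_succ_of_le (Nat.right_le_pair _ _)
    rw [basicBall, Metric.mem_ball, dist_comm] at hk
    have h : SeenMeeting n k (Encodable.encode w)
        (initSeg t (Nat.pair k (Encodable.encode w) + 1)) := by
      refine ⟨?_, by rwa [word_encode]⟩
      rw [getD_initSeg h1]
      exact (tree_encode ht w).2 hw
    simp [posEntry, h]

theorem cauchyName_zero (n : ℕ) : (cauchyRep n).IsName (fun _ => 0) (ratPoint n 0) :=
  ⟨fun i _ _ => by
    rw [dist_self]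
    positivity, tendsto_const_nhds⟩

end

/-- The number `s = ⟨b, ⟨c, j + 1⟩⟩` shows that the next bit is `b`: the entry `j` of the name is
close enough to the point of the circle coded by the word with the number `c`. -/
def SeenBit (n m s : ℕ) (l : List ℕ) : Prop :=
  (word s.unpair.2.unpair.1).length = m + 1 ∧
  s.unpair.1 = ((word s.unpair.2.unpair.1).getD m false).toNat ∧
  s.unpair.2.unpair.2 - 1 < l.length ∧
  dist (ratPoint n (l.getD (s.unpair.2.unpair.2 - 1) 0))
    (circlePoint n (word s.unpair.2.unpair.1)) <
      (8 : ℝ)⁻¹ ^ (m + 1) / 2 - (2 : ℝ)⁻¹ ^ (s.unpair.2.unpair.2 - 1)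

theorem primrecPred_seenBit (n : ℕ) :
    PrimrecPred fun a : ℕ × ℕ × List ℕ => SeenBit n a.1 a.2.1 a.2.2 := by
  have hm : Primrec fun a : ℕ × ℕ × List ℕ => a.1 + 1 := Primrec.succ.comp .fst
  have hs : Primrec fun a : ℕ × ℕ × List ℕ => a.2.1 := Primrec.fst.comp .snd
  have hl : Primrec fun a : ℕ × ℕ × List ℕ => a.2.2 := Primrec.snd.comp .snd
  have hw : Primrec fun a : ℕ × ℕ × List ℕ => word a.2.1.unpair.2.unpair.1 :=
    primrec_word.comp (primrec_unpair_fst (primrec_unpair_snd hs))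
  have hj : Primrec fun a : ℕ × ℕ × List ℕ => a.2.1.unpair.2.unpair.2 - 1 :=
    Primrec.nat_sub.comp (primrec_unpair_snd (primrec_unpair_snd hs)) (.const 1)
  refine PrimrecPred.and (Primrec.eq.comp (Primrec.list_length.comp hw) hm) (PrimrecPred.and
    (Primrec.eq.comp (primrec_unpair_fst hs) ((Primrec.dom_bool Bool.toNat).comp
      ((Primrec.list_getD false).comp hw .fst))) (PrimrecPred.and
    (Primrec.nat_lt.comp hj (Primrec.list_length.comp hl))
    (primrecPred_dist_circlePoint_lt n (primrec_getD hl hj) hw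
      (((RatPrimrec.inv_pow (b := 8) hm (by norm_num)).mul
        (RatPrimrec.div_nat (Primrec.const 1) (Primrec.const 2) fun _ => two_pos)).sub
        (RatPrimrec.inv_pow hj two_pos)) fun a => ?_)))
  push_cast
  ring

/-- Subtracting the error `2⁻¹ ^ j` of entry `j` of the name ensures that `y` itself is near the
word, which by uniqueness is then the initial segment of the path. Any successful stage therefore
gives the right bit. -/
theorem seenBit_spec {n : ℕ} (hn : 2 ≤ n) {q : Baire} {y : Euc n} {z : ℕ → Bool}
    (hq : (cauchyRep n).IsName q y) (hz : ∀ m, NearWord n y (initSeg z m)) {m s : ℕ}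
    (h : SeenBit n m s (initSeg q s)) : s.unpair.1 = (z m).toNat := by
  obtain ⟨hlen, hbit, hj, hdist⟩ := h
  rw [length_initSeg] at hj
  rw [getD_initSeg hj] at hdist
  have h1 := dist_cauchyName_le hq (s.unpair.2.unpair.2 - 1)
  have h2 := dist_triangle_left y (circlePoint n (word s.unpair.2.unpair.1))
    (ratPoint n (q (s.unpair.2.unpair.2 - 1)))
  have hnear : NearWord n y (word s.unpair.2.unpair.1) := by
    rw [NearWord, hlen]
    linarith
  rw [hbit, NearWord.unique hn hnear (hz (m + 1)) (by rw [hlen, length_initSeg]), List.getD,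
    getElem?_initSeg (Nat.lt_succ_self m), Option.getD_some]

theorem exists_seenBit {n : ℕ} {q : Baire} {y : Euc n} {z : ℕ → Bool}
    (hq : (cauchyRep n).IsName q y) (hz : ∀ m, NearWord n y (initSeg z m)) (m : ℕ) :
    ∃ s, SeenBit n m s (initSeg q s) := by
  have hnear := hz (m + 1)
  rw [NearWord, length_initSeg] at hnear
  obtain ⟨j, hj⟩ := exists_inv_pow_lt (half_pos (sub_pos.2 hnear))
  -- Coding `j + 1` instead of `j` keeps the entry `j` inside the initial segment of length `s`.
  have hlt : j < Nat.pair (z m).toNat (Nat.pair (Encodable.encode (initSeg z (m + 1))) (j + 1)) :=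
    (Nat.right_le_pair _ _).trans (Nat.right_le_pair _ _)
  refine ⟨Nat.pair (z m).toNat (Nat.pair (Encodable.encode (initSeg z (m + 1))) (j + 1)), ?_⟩
  simp only [SeenBit, Nat.unpair_pair, word_encode, Nat.add_sub_cancel, length_initSeg, true_and,
    getD_initSeg hlt]
  refine ⟨?_, hlt, ?_⟩
  · rw [List.getD, getElem?_initSeg (Nat.lt_succ_self m), Option.getD_some]
  · have h1 := dist_cauchyName_le hq j
    have h2 := dist_triangle (ratPoint n (q j)) y (circlePoint n (initSeg z (m + 1)))
    linarith

theorem WKL_le_proj {n : ℕ} (hn : 2 ≤ n) : StrongWeihrauchLE WKL (Proj n) := by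
  have hquarter : Primrec fun m : ℕ => m / 2 / 2 :=
    Primrec.nat_div.comp (Primrec.nat_div.comp .id (.const 2)) (.const 2)
  -- Even positions hold the constant name 0 of the origin; odd positions alternate between the
  -- negative and the positive name, whose entries have index `m / 2 / 2`.
  have hpre : Primrec₂ fun (m : ℕ) (l : List ℕ) => if m % 2 = 0 then 0 else
      if m / 2 % 2 = 0 then negEntry n (m / 2 / 2) l else posEntry n (m / 2 / 2) l := by
    refine Primrec.ite (Primrec.eq.comp (Primrec.nat_mod.comp .fst (.const 2)) (.const 0))
      (.const 0) (Primrec.ite (Primrec.eq.comp (Primrec.nat_mod.comp (Primrec.nat_div.comp .fst (.const 2))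
        (.const 2)) (.const 0)) ?_ ?_)
    · exact (primrec_negEntry n).comp (hquarter.comp .fst) .snd
    · exact (primrec_posEntry n).comp (hquarter.comp .fst) .snd
  refine strongWeihrauchLE_of_initSeg hpre (Primrec.succ.comp hquarter) (primrecPred_seenBit n) ?_
  intro t T ht hT
  have hne : (treeSet n T).Nonempty := by
    obtain ⟨w, hw, -⟩ := exists_mem_length hT 0
    exact ⟨_, subset_closure ⟨w, hw, rfl⟩⟩
  refine ⟨(ratPoint n 0, ⟨treeSet n T, isClosed_closure, hne⟩), Set.mem_univ _, ?_, ?_⟩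
  · exact ⟨fun _ => 0, join (fun s => negEntry n s (initSeg t (s + 1)))
      (fun s => posEntry n s (initSeg t (s + 1))), rfl, cauchyName_zero n, _, _, rfl,
      negName_treeSet hn ht, posName_treeSet hn ht hT⟩
  · intro q y hy hq
    obtain ⟨z, hz, hnear⟩ := exists_path_of_projPoint hn hT hy
    refine ⟨exists_seenBit hq hnear, fun r hr => ⟨z, hz, fun m => ?_⟩⟩
    obtain ⟨s, hs, hsr⟩ := hr m
    rw [← hsr]
    exact seenBit_spec hn hq hnear hs

end Wei

end

theorem mainTheorem1 (n : ℕ) (hn : 2 ≤ n) :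
    Wei.StrongWeihrauchEquiv (Wei.Proj n) Wei.WKL :=
  ⟨Wei.proj_le_WKL n, Wei.WKL_le_proj hn⟩
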